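/- Let $0<\alpha<1$, $T>0$, $\Lambda=[0,T]$, and let $G:[0,\infty)\to[0,\infty)$ be an $N$-function, i.e. $G$ is convex and continuous, $G(s)=0$ iff $s=0$, $\lim_{s\to0^+}G(s)/s=0$ and $\lim_{s\to\infty}G(s)/s=\infty$. Let $L^G=L^G(\Lambda)$ be the Orlicz space of measurable $v:\Lambda\to\mathbb R$ with $\int_\Lambda G(\gamma|v|)\,dx<\infty$ for some $\gamma>0$, with the Luxemburg norm $\|v\|_G=\inf\{\gamma>0:\int_\Lambda G(|v|/\gamma)\,dx\le1\}$. For $v\in L^G$ (with a value $v(0)$) let $${}^C\mathfrak D^\alpha_{0^+}v=\frac{d}{dx}\left[\frac1{\Gamma(1-\alpha)}\int_0^x (v(t)-v(0))(x-t)^{-\alpha}\,dt\right]$$ be its left Caputo derivative, $d/dx$ being the weak derivative on $(0,T)$, and let $$\mathcal O=\{v\in L^G:\ {}^C\mathfrak D^\alpha_{0^+}v \text{ exists and belongs to } L^G\}.$$ Put $\rho_G(v)=\int_\Lambda\big[G(|v|)+G(|{}^C\mathfrak D^\alpha_{0^+}v|)\big]dx$ and $$\|v\|=\inf\{\gamma>0:\rho_G(v/\gamma)\le1\},\qquad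 \|v\|_{\mathcal O}=\|v\|_G+\|{}^C\mathfrak D^\alpha_{0^+}v\|_G ;$$ functions at distance zero from each other are identified. Assume that $G$ satisfies the $\Delta_2$-condition (there is $k>0$ with $G(2s)\le kG(s)$ for all $s\ge0$) and that $s\mapsto G(\sqrt s)$ is convex on $[0,\infty)$. Then: 1. $(\mathcal O,\|\cdot\|)$ is separable, uniformly convex and reflexive. 2. $\|v\|\le\|v\|_{\mathcal O}\le2\|v\|$ for all $v\in\mathcal O$, and $(\mathcal O,\|\cdot\|_{\mathcal O})$ is separable and reflexive as well. -/

import Mathlib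

open MeasureTheory Set Filter Topology
open scoped ENNReal ContDiff

noncomputable section

/-- An `N`-function, as a function on `[0, ∞)` (values at negative arguments are never used):
convex, continuous, zero exactly at `0`, with `G s / s → 0` as `s → 0⁺` and
`G s / s → ∞` as `s → ∞`. -/
structure NFunction where
  toFun : ℝ → ℝ
  convexOn : ConvexOn ℝ (Ici 0) toFun
  continuousOn : ContinuousOn toFun (Ici 0)
  map_zero : toFun 0 = 0
  pos : ∀ s, 0 < s → 0 < toFun s
  tendsto_zero : Tendsto (fun s => toFun s / s) (𝓝[>] 0) (𝓝 0)
  tendsto_atTop : Tendsto (fun s => toFun s / s) atTop atTop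

instance : CoeFun NFunction (fun _ => ℝ → ℝ) := ⟨NFunction.toFun⟩

/-- The global `Δ₂`-condition. -/
def NFunction.DeltaTwo (G : NFunction) : Prop :=
  ∃ k : ℝ, 0 < k ∧ ∀ s : ℝ, 0 ≤ s → G (2 * s) ≤ k * G s

/-- The measure space `Λ = [0, T]`: Lebesgue measure restricted to `[0, T]`. -/
abbrev lam (T : ℝ) : Measure ℝ := volume.restrict (Icc 0 T)

/-- The modular `∫ G(|v|) dμ`, with values in `[0, ∞]`. -/
def orliczModular (G : NFunction) (μ : Measure ℝ) (v : ℝ → ℝ) : ℝ≥0∞ :=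
  ∫⁻ x, ENNReal.ofReal (G |v x|) ∂μ

/-- Membership in the Orlicz space `L^G(μ)`. -/
def MemOrlicz (G : NFunction) (μ : Measure ℝ) (v : ℝ → ℝ) : Prop :=
  AEMeasurable v μ ∧ ∃ γ : ℝ, 0 < γ ∧ ∫⁻ x, ENNReal.ofReal (G (γ * |v x|)) ∂μ < ⊤

/-- The Luxemburg norm `‖v‖_G`. -/
def luxNorm (G : NFunction) (μ : Measure ℝ) (v : ℝ → ℝ) : ℝ :=
  sInf {γ : ℝ | 0 < γ ∧ ∫⁻ x, ENNReal.ofReal (G (|v x| / γ)) ∂μ ≤ 1}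

/-- The left-sided Riemann-Liouville fractional integral of order `β`, based at `0`. -/
def rlIntegral (β : ℝ) (v : ℝ → ℝ) (x : ℝ) : ℝ :=
  (Real.Gamma β)⁻¹ * ∫ t in (0 : ℝ)..x, v t * (x - t) ^ (β - 1)

/-- `w` is a weak derivative of `u` on the open interval `(0, T)`. -/
def HasWeakDerivOn (T : ℝ) (u w : ℝ → ℝ) : Prop :=
  LocallyIntegrableOn u (Ioo 0 T) ∧ LocallyIntegrableOn w (Ioo 0 T) ∧
    ∀ φ : ℝ → ℝ, ContDiff ℝ ∞ φ → HasCompactSupport φ → tsupport φ ⊆ Ioo 0 T →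
      ∫ x in Ioo 0 T, u x * deriv φ x = - ∫ x in Ioo 0 T, w x * φ x

/-- `w` is the Caputo derivative of order `α ∈ (0, 1)` of `v` on `[0, T]`, that is, the
derivative of the Riemann-Liouville integral of order `1 - α` of `v - v(0)`. -/
def HasCaputoDeriv (α T : ℝ) (v w : ℝ → ℝ) : Prop :=
  HasWeakDerivOn T (rlIntegral (1 - α) (fun t => v t - v 0)) w

open Classical in
/-- The Caputo derivative (a version of it; it is unique almost everywhere on `[0, T]`);
the value `0` is assigned if it does not exist. -/
def caputoDeriv (α T : ℝ) (v : ℝ → ℝ) : ℝ → ℝ :=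
  if h : ∃ w, HasCaputoDeriv α T v w then h.choose else 0

/-! ### Elementary facts on `N`-functions and modulars -/

lemma NFunction.nonneg (G : NFunction) {s : ℝ} (hs : 0 ≤ s) : 0 ≤ G s := by
  rcases hs.eq_or_lt with rfl | h
  · rw [G.map_zero]
  · exact (G.pos s h).le

lemma NFunction.mono (G : NFunction) {s t : ℝ} (hs : 0 ≤ s) (hst : s ≤ t) : G s ≤ G t := by
  rcases hs.eq_or_lt with rfl | h
  · rw [G.map_zero]; exact G.nonneg hst
  have ht : 0 < t := h.trans_le hst
  have h1 : 0 ≤ 1 - s / t := by rw [sub_nonneg, div_le_one ht]; exact hst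
  have := G.convexOn.2 (x := 0) (y := t) (by simp) (by simpa using ht.le) h1
    (by positivity : 0 ≤ s / t) (by ring)
  simp only [smul_eq_mul, mul_zero, zero_add, G.map_zero, div_mul_cancel₀ _ ht.ne'] at this
  have h3 : s / t * G t ≤ 1 * G t :=
    mul_le_mul_of_nonneg_right (by linarith) (G.nonneg ht.le)
  linarith

lemma NFunction.convex_abs (G : NFunction) {a b : ℝ} (ha : 0 ≤ a) (hb : 0 ≤ b) (hab : a + b = 1)
    (x y : ℝ) : G |a * x + b * y| ≤ a * G |x| + b * G |y| := by
  have h1 : |a * x + b * y| ≤ a * |x| + b * |y| := by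
    refine (abs_add_le _ _).trans ?_
    rw [abs_mul, abs_mul, abs_of_nonneg ha, abs_of_nonneg hb]
  refine (G.mono (abs_nonneg _) h1).trans ?_
  exact G.convexOn.2 (abs_nonneg x) (abs_nonneg y) ha hb hab

lemma NFunction.continuous_abs (G : NFunction) : Continuous (fun x : ℝ => G |x|) :=
  G.continuousOn.comp_continuous _root_.continuous_abs (fun x => abs_nonneg x)

lemma aemeasurable_orlicz (G : NFunction) {μ : Measure ℝ} {v : ℝ → ℝ} (hv : AEMeasurable v μ) :
    AEMeasurable (fun x => ENNReal.ofReal (G |v x|)) μ :=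
  (G.continuous_abs.measurable.comp_aemeasurable hv).ennreal_ofReal

lemma orliczModular_convex (G : NFunction) {μ : Measure ℝ} {u v : ℝ → ℝ}
    (hu : AEMeasurable u μ) {a b : ℝ} (ha : 0 ≤ a) (hb : 0 ≤ b) (hab : a + b = 1) :
    orliczModular G μ (a • u + b • v) ≤
      ENNReal.ofReal a * orliczModular G μ u + ENNReal.ofReal b * orliczModular G μ v := by
  unfold orliczModular
  rw [← lintegral_const_mul' _ _ ENNReal.ofReal_ne_top,
    ← lintegral_const_mul' _ _ ENNReal.ofReal_ne_top,
    ← lintegral_add_left' ((aemeasurable_orlicz G hu).const_mul _)]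
  refine lintegral_mono fun x => ?_
  rw [← ENNReal.ofReal_mul ha, ← ENNReal.ofReal_mul hb, ← ENNReal.ofReal_add
    (mul_nonneg ha (G.nonneg (abs_nonneg _))) (mul_nonneg hb (G.nonneg (abs_nonneg _)))]
  exact ENNReal.ofReal_le_ofReal (G.convex_abs ha hb hab (u x) (v x))

lemma orliczModular_zero (G : NFunction) (μ : Measure ℝ) : orliczModular G μ 0 = 0 := by
  simp [orliczModular, G.map_zero]

lemma orliczModular_neg (G : NFunction) (μ : Measure ℝ) (v : ℝ → ℝ) :
    orliczModular G μ (-v) = orliczModular G μ v := by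
  simp [orliczModular]

lemma orliczModular_congr (G : NFunction) {μ : Measure ℝ} {u v : ℝ → ℝ} (h : u =ᵐ[μ] v) :
    orliczModular G μ u = orliczModular G μ v :=
  lintegral_congr_ae (h.mono fun x hx => by simp only [hx])

lemma orliczModular_smul_mono (G : NFunction) (μ : Measure ℝ) (v : ℝ → ℝ) {a b : ℝ} (ha : 0 ≤ a)
    (hab : a ≤ b) : orliczModular G μ (a • v) ≤ orliczModular G μ (b • v) := by
  refine lintegral_mono fun x => ENNReal.ofReal_le_ofReal (G.mono (abs_nonneg _) ?_)
  simp only [Pi.smul_apply, smul_eq_mul, abs_mul, abs_of_nonneg ha, abs_of_nonneg (ha.trans hab)]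
  gcongr

lemma orliczModular_smul (G : NFunction) (μ : Measure ℝ) (v : ℝ → ℝ) {γ : ℝ} (hγ : 0 < γ) :
    orliczModular G μ (γ • v) = ∫⁻ x, ENNReal.ofReal (G (γ * |v x|)) ∂μ := by
  simp [orliczModular, abs_mul, abs_of_pos hγ]

lemma memOrlicz_iff {G : NFunction} {μ : Measure ℝ} {v : ℝ → ℝ} : MemOrlicz G μ v ↔
    AEMeasurable v μ ∧ ∃ γ : ℝ, 0 < γ ∧ orliczModular G μ (γ • v) < ⊤ := by
  refine and_congr_right fun _ => exists_congr fun γ => and_congr_right fun hγ => ?_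
  rw [orliczModular_smul G μ v hγ]

lemma luxNorm_eq (G : NFunction) (μ : Measure ℝ) (v : ℝ → ℝ) :
    luxNorm G μ v = sInf {γ : ℝ | 0 < γ ∧ orliczModular G μ (γ⁻¹ • v) ≤ 1} := by
  unfold luxNorm
  congr 1
  ext γ
  refine and_congr_right fun hγ => ?_
  rw [orliczModular_smul G μ v (inv_pos.2 hγ)]
  simp only [div_eq_inv_mul]

lemma luxNorm_congr (G : NFunction) {μ : Measure ℝ} {u v : ℝ → ℝ} (h : u =ᵐ[μ] v) :
    luxNorm G μ u = luxNorm G μ v := by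
  simp only [luxNorm_eq]
  congr 1
  ext γ
  rw [mem_ofPred_eq, mem_ofPred_eq, orliczModular_congr G (h.const_smul γ⁻¹)]

lemma MemOrlicz.congr {G : NFunction} {μ : Measure ℝ} {u v : ℝ → ℝ} (hu : MemOrlicz G μ u)
    (h : u =ᵐ[μ] v) : MemOrlicz G μ v := by
  rw [memOrlicz_iff] at hu ⊢
  obtain ⟨h1, γ, hγ, h2⟩ := hu
  exact ⟨h1.congr h, γ, hγ, by rwa [← orliczModular_congr G (h.const_smul γ)]⟩

/-- The Orlicz class `L^G(μ)` as a vector space of functions. -/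
def orliczSubmodule (G : NFunction) (μ : Measure ℝ) : Submodule ℝ (ℝ → ℝ) where
  carrier := {v | MemOrlicz G μ v}
  zero_mem' := memOrlicz_iff.2 ⟨aemeasurable_const, 1, one_pos, by
    simp [orliczModular_zero]⟩
  add_mem' := by
    intro u v hu hv
    simp only [mem_ofPred_eq, memOrlicz_iff] at hu hv ⊢
    obtain ⟨hu, a, ha, hau⟩ := hu
    obtain ⟨hv, b, hb, hbv⟩ := hv
    have hm : 0 < min a b := lt_min ha hb
    refine ⟨hu.add hv, min a b / 2, by positivity, ?_⟩
    have e : (min a b / 2) • (u + v) =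
        (1 / 2 : ℝ) • (min a b • u) + (1 / 2 : ℝ) • (min a b • v) := by
      ext x; simp; ring
    rw [e]
    refine (orliczModular_convex G (hu.const_smul _) (by norm_num) (by norm_num)
      (by norm_num)).trans_lt ?_
    refine ENNReal.add_lt_top.2 ⟨ENNReal.mul_lt_top ENNReal.ofReal_lt_top ?_,
      ENNReal.mul_lt_top ENNReal.ofReal_lt_top ?_⟩
    · exact (orliczModular_smul_mono G μ u hm.le (min_le_left _ _)).trans_lt hau
    · exact (orliczModular_smul_mono G μ v hm.le (min_le_right _ _)).trans_lt hbv
  smul_mem' := by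
    intro c v hv
    simp only [mem_ofPred_eq, memOrlicz_iff] at hv ⊢
    obtain ⟨hv, a, ha, hav⟩ := hv
    refine ⟨hv.const_smul c, a / (|c| + 1), by positivity, ?_⟩
    refine lt_of_le_of_lt ?_ hav
    refine lintegral_mono fun x => ENNReal.ofReal_le_ofReal (G.mono (abs_nonneg _) ?_)
    simp only [Pi.smul_apply, smul_eq_mul, abs_mul]
    rw [← mul_assoc]
    gcongr
    rw [abs_div, abs_of_pos (by positivity : 0 < |c| + 1), div_mul_eq_mul_div,
      div_le_iff₀ (by positivity)]
    gcongr
    linarith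

/-- A finite-up-to-scaling convex even modular defines a seminorm. -/
def modularSeminorm {V : Type*} [AddCommGroup V] [Module ℝ V] (ρ : V → ℝ≥0∞) (h0 : ρ 0 = 0)
    (hneg : ∀ v, ρ (-v) = ρ v)
    (hconv : ∀ (u v : V) (a b : ℝ), 0 ≤ a → 0 ≤ b → a + b = 1 →
      ρ (a • u + b • v) ≤ ENNReal.ofReal a * ρ u + ENNReal.ofReal b * ρ v)
    (hfin : ∀ v, ∃ γ : ℝ, 0 < γ ∧ ρ (γ • v) < ⊤) : Seminorm ℝ V :=
  have hsc : ∀ (v : V) (c : ℝ), 0 ≤ c → c ≤ 1 → ρ (c • v) ≤ ENNReal.ofReal c * ρ v := by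
    intro v c hc hc1
    have := hconv v 0 c (1 - c) hc (by linarith) (by ring)
    simpa [h0] using this
  have hsc1 : ∀ (v : V) (c : ℝ), |c| ≤ 1 → ρ (c • v) ≤ ρ v := by
    intro v c hc
    have e : ρ (c • v) = ρ (|c| • v) := by
      rcases abs_choice c with h | h
      · rw [h]
      · rw [h, neg_smul, hneg]
    rw [e]
    refine (hsc v _ (abs_nonneg c) hc).trans ?_
    calc _ ≤ 1 * ρ v := by gcongr; exact ENNReal.ofReal_le_one.2 hc
      _ = _ := one_mul _
  have hgauge : ∀ v, sInf {γ : ℝ | 0 < γ ∧ ρ (γ⁻¹ • v) ≤ 1} = gauge {x | ρ x ≤ 1} v := by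
    intro v
    rw [gauge_def']
    rfl
  have hbal : Balanced ℝ {x | ρ x ≤ 1} := by
    rw [balanced_iff_smul_mem]
    intro c hc x hx
    exact (hsc1 x c hc).trans hx
  have hcvx : Convex ℝ {x | ρ x ≤ 1} := by
    intro x hx y hy a b ha hb hab
    refine (hconv x y a b ha hb hab).trans ?_
    calc _ ≤ ENNReal.ofReal a * 1 + ENNReal.ofReal b * 1 := by gcongr; exacts [hx, hy]
      _ = 1 := by rw [mul_one, mul_one, ← ENNReal.ofReal_add ha hb, hab, ENNReal.ofReal_one]
  have habs : Absorbent ℝ {x | ρ x ≤ 1} := by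
    intro v
    obtain ⟨γ, hγ, hv⟩ := hfin v
    set M := (ρ (γ • v)).toReal
    have hM : 0 ≤ M := ENNReal.toReal_nonneg
    have hmem : ρ (((M + 1)⁻¹ * γ) • v) ≤ 1 := by
      rw [mul_smul]
      refine (hsc _ _ (by positivity) (inv_le_one_of_one_le₀ (by linarith))).trans ?_
      rw [← ENNReal.ofReal_toReal hv.ne, ← ENNReal.ofReal_mul (by positivity)]
      refine ENNReal.ofReal_le_one.2 ?_
      rw [inv_mul_le_iff₀ (by positivity)]
      change M ≤ _
      linarith
    refine Absorbs.of_norm ⟨((M + 1)⁻¹ * γ)⁻¹, fun c hc => ?_⟩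
    have hd : 0 < (M + 1)⁻¹ * γ := by positivity
    have hc0 : 0 < ‖c‖ := (inv_pos.2 hd).trans_le hc
    rw [singleton_subset_iff, mem_smul_set_iff_inv_smul_mem₀ (norm_pos_iff.1 hc0)]
    have e : c⁻¹ • v = (c⁻¹ * ((M + 1)⁻¹ * γ)⁻¹) • (((M + 1)⁻¹ * γ) • v) := by
      rw [smul_smul, mul_assoc, inv_mul_cancel₀ hd.ne', mul_one]
    rw [e]
    refine (hsc1 _ _ ?_).trans hmem
    rw [abs_mul, abs_inv, abs_of_pos (inv_pos.2 hd), inv_mul_le_iff₀ (by simpa using hc0),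
      mul_one]
    exact hc
  Seminorm.of (fun v => sInf {γ : ℝ | 0 < γ ∧ ρ (γ⁻¹ • v) ≤ 1})
    (fun u v => by simp only [hgauge]; exact gauge_add_le hcvx habs u v)
    (fun c v => by simp only [hgauge]; exact gauge_smul hbal c v)

/-- The Luxemburg norm as a seminorm on the functions of class `L^G(μ)`. -/
def luxSeminorm (G : NFunction) (μ : Measure ℝ) : Seminorm ℝ (orliczSubmodule G μ) :=
  modularSeminorm (fun v => orliczModular G μ v) (orliczModular_zero G μ)
    (fun v => orliczModular_neg G μ v)
    (fun u _ _ _ ha hb hab => orliczModular_convex G u.2.1 ha hb hab)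
    (fun v => (memOrlicz_iff.1 v.2).2)

lemma luxSeminorm_apply (G : NFunction) (μ : Measure ℝ) (v : orliczSubmodule G μ) :
    luxSeminorm G μ v = luxNorm G μ v :=
  (luxNorm_eq G μ v).symm

lemma luxNorm_add_le (G : NFunction) (μ : Measure ℝ) {u v : ℝ → ℝ} (hu : MemOrlicz G μ u)
    (hv : MemOrlicz G μ v) : luxNorm G μ (u + v) ≤ luxNorm G μ u + luxNorm G μ v := by
  have := map_add_le_add (luxSeminorm G μ) ⟨u, hu⟩ ⟨v, hv⟩
  simp only [luxSeminorm_apply] at this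
  exact this

lemma luxNorm_smul (G : NFunction) (μ : Measure ℝ) {v : ℝ → ℝ} (hv : MemOrlicz G μ v) (c : ℝ) :
    luxNorm G μ (c • v) = ‖c‖ * luxNorm G μ v := by
  have := map_smul_eq_mul (luxSeminorm G μ) c ⟨v, hv⟩
  simp only [luxSeminorm_apply] at this
  exact this

lemma MemOrlicz.integrable {G : NFunction} {μ : Measure ℝ} [IsFiniteMeasure μ] {v : ℝ → ℝ}
    (hv : MemOrlicz G μ v) : Integrable v μ := by
  obtain ⟨hm, γ, hγ, hfin⟩ := memOrlicz_iff.1 hv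
  have hi : Integrable (fun x => G |(γ • v) x|) μ := by
    refine ⟨(G.continuous_abs.measurable.comp_aemeasurable
      (hm.const_smul γ)).aestronglyMeasurable, ?_⟩
    rw [hasFiniteIntegral_iff_ofReal
      (Eventually.of_forall fun x => G.nonneg (abs_nonneg _))]
    exact hfin
  obtain ⟨s₀, hs₀⟩ := eventually_atTop.1
    ((G.tendsto_atTop.eventually_ge_atTop 1).and (eventually_gt_atTop 0))
  have hb : ∀ s, 0 ≤ s → s ≤ |s₀| + G s := by
    intro s hs
    rcases le_total s₀ s with h | h
    · obtain ⟨h1, h2⟩ := hs₀ s h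
      rw [le_div_iff₀ h2] at h1
      have := abs_nonneg s₀
      linarith
    · have := G.nonneg hs
      have := le_abs_self s₀
      linarith
  have hI : Integrable (γ • v) μ := by
    refine Integrable.mono' ((integrable_const |s₀|).add hi)
      (hm.const_smul γ).aestronglyMeasurable (Eventually.of_forall fun x => ?_)
    exact hb _ (abs_nonneg _)
  have := hI.smul γ⁻¹
  rwa [smul_smul, inv_mul_cancel₀ hγ.ne', one_smul] at this

/-! ### Linearity of the Caputo derivative -/

lemma ae_intervalIntegrable_rl {β T : ℝ} (hβ : 0 < β) {f : ℝ → ℝ}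
    (hf : IntegrableOn f (Icc 0 T)) :
    ∀ᵐ x, x ∈ Ioo 0 T →
      IntervalIntegrable (fun t => f t * (x - t) ^ (β - 1)) volume 0 x := by
  rcases le_or_gt T 0 with hT | hT
  · exact Eventually.of_forall fun x hx => absurd (hx.1.trans hx.2) (not_lt.2 hT)
  have hk : IntegrableOn (fun t : ℝ => t ^ (β - 1)) (Ioc 0 T) := by
    have := intervalIntegral.intervalIntegrable_rpow' (a := 0) (b := T)
      (by linarith : -1 < β - 1)
    rwa [intervalIntegrable_iff_integrableOn_Ioc_of_le hT.le] at this
  have h := Integrable.ae_convolution_exists (μ := volume) (ν := volume)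
    (ContinuousLinearMap.mul ℝ ℝ)
    ((integrable_indicator_iff measurableSet_Icc).2 hf)
    ((integrable_indicator_iff measurableSet_Ioc).2 hk)
  filter_upwards [h] with x hx hxT
  rw [intervalIntegrable_iff_integrableOn_Ioo_of_le hxT.1.le]
  refine (Integrable.integrableOn hx (s := Ioo 0 x)).congr_fun ?_ measurableSet_Ioo
  intro t ht
  have h1 : t ∈ Icc 0 T := ⟨ht.1.le, (ht.2.trans hxT.2).le⟩
  have h2 : x - t ∈ Ioc 0 T := ⟨by linarith [ht.2], by linarith [ht.1, hxT.2]⟩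
  simp [indicator_of_mem h1, indicator_of_mem h2]

lemma rlIntegral_linear_ae {β T : ℝ} (hβ : 0 < β) {f g : ℝ → ℝ}
    (hf : IntegrableOn f (Icc 0 T)) (hg : IntegrableOn g (Icc 0 T)) (a b : ℝ) :
    ∀ᵐ x, x ∈ Ioo 0 T → rlIntegral β (fun t => a * f t + b * g t) x =
      a * rlIntegral β f x + b * rlIntegral β g x := by
  filter_upwards [ae_intervalIntegrable_rl hβ hf, ae_intervalIntegrable_rl hβ hg] with x h1 h2 hx
  unfold rlIntegral
  have e : (fun t => (a * f t + b * g t) * (x - t) ^ (β - 1)) =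
      fun t => a * (f t * (x - t) ^ (β - 1)) + b * (g t * (x - t) ^ (β - 1)) := by
    ext t; ring
  rw [e, intervalIntegral.integral_add ((h1 hx).const_mul a) ((h2 hx).const_mul b),
    intervalIntegral.integral_const_mul, intervalIntegral.integral_const_mul]
  ring

lemma integrableOn_mul_test {T : ℝ} {u ψ : ℝ → ℝ} (hu : LocallyIntegrableOn u (Ioo 0 T))
    (hψ : Continuous ψ) (hc : HasCompactSupport ψ) (hs : tsupport ψ ⊆ Ioo 0 T) :
    IntegrableOn (fun x => u x * ψ x) (Ioo 0 T) := by
  have h1 : IntegrableOn (fun x => u x * ψ x) (tsupport ψ) :=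
    (hu.integrableOn_compact_subset hs hc).mul_continuousOn hψ.continuousOn hc
  refine h1.of_forall_sdiff_eq_zero measurableSet_Ioo fun x hx => ?_
  rw [image_eq_zero_of_notMem_tsupport hx.2, mul_zero]

lemma HasWeakDerivOn.congr_left {T : ℝ} {u u' w : ℝ → ℝ} (h : HasWeakDerivOn T u w)
    (he : ∀ᵐ x, x ∈ Ioo 0 T → u x = u' x) : HasWeakDerivOn T u' w := by
  have he' : u =ᵐ[volume.restrict (Ioo 0 T)] u' := (ae_restrict_iff' measurableSet_Ioo).2 he
  refine ⟨?_, h.2.1, fun φ h1 h2 h3 => ?_⟩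
  · rw [locallyIntegrableOn_iff isOpen_Ioo.isLocallyClosed] at *
    intro k hk hkc
    exact ((locallyIntegrableOn_iff isOpen_Ioo.isLocallyClosed).1 h.1 k hk hkc).congr_fun_ae
      (ae_restrict_of_ae_restrict_of_subset hk he')
  · rw [← h.2.2 φ h1 h2 h3]
    exact integral_congr_ae (he'.mono fun x hx => by simp only [hx])

lemma HasWeakDerivOn.linear {T : ℝ} {u₁ u₂ w₁ w₂ : ℝ → ℝ} (h₁ : HasWeakDerivOn T u₁ w₁)
    (h₂ : HasWeakDerivOn T u₂ w₂) (a b : ℝ) :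
    HasWeakDerivOn T (fun x => a * u₁ x + b * u₂ x) (a • w₁ + b • w₂) := by
  refine ⟨(h₁.1.smul a).add (h₂.1.smul b), (h₁.2.1.smul a).add (h₂.2.1.smul b), ?_⟩
  intro φ hφ hc hs
  have hd : Continuous (deriv φ) := hφ.continuous_deriv (by simp)
  have hdc : HasCompactSupport (deriv φ) := hc.deriv
  have hds : tsupport (deriv φ) ⊆ Ioo 0 T :=
    (closure_minimal (support_deriv_subset) isClosed_closure).trans hs
  have i1 := integrableOn_mul_test h₁.1 hd hdc hds
  have i2 := integrableOn_mul_test h₂.1 hd hdc hds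
  have j1 := integrableOn_mul_test h₁.2.1 hφ.continuous hc hs
  have j2 := integrableOn_mul_test h₂.2.1 hφ.continuous hc hs
  have e1 : (fun x => (a * u₁ x + b * u₂ x) * deriv φ x) =
      fun x => a * (u₁ x * deriv φ x) + b * (u₂ x * deriv φ x) := by ext x; ring
  have e2 : (fun x => (a • w₁ + b • w₂) x * φ x) =
      fun x => a * (w₁ x * φ x) + b * (w₂ x * φ x) := by ext x; simp; ring
  rw [e1, e2, integral_add (i1.const_mul a) (i2.const_mul b),
    integral_add (j1.const_mul a) (j2.const_mul b), integral_const_mul, integral_const_mul,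
    integral_const_mul, integral_const_mul, h₁.2.2 φ hφ hc hs, h₂.2.2 φ hφ hc hs]
  ring

lemma HasWeakDerivOn.unique {T : ℝ} {u w w' : ℝ → ℝ} (h : HasWeakDerivOn T u w)
    (h' : HasWeakDerivOn T u w') : w =ᵐ[lam T] w' := by
  have key : ∀ᵐ x, x ∈ Ioo 0 T → (w - w') x = 0 := by
    refine isOpen_Ioo.ae_eq_zero_of_integral_contDiff_smul_eq_zero (h.2.1.sub h'.2.1) ?_
    intro φ hφ hc hs
    have j1 := integrableOn_mul_test h.2.1 hφ.continuous hc hs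
    have j2 := integrableOn_mul_test h'.2.1 hφ.continuous hc hs
    have h1 := h.2.2 φ hφ hc hs
    have h2 := h'.2.2 φ hφ hc hs
    rw [h1, neg_inj] at h2
    rw [← setIntegral_eq_integral_of_forall_compl_eq_zero (s := Ioo 0 T)]
    · have e : (fun x => φ x • (w - w') x) = fun x => w x * φ x - w' x * φ x := by
        ext x; simp; ring
      rw [e, integral_sub j1 j2, h2, sub_self]
    · intro x hx
      rw [image_eq_zero_of_notMem_tsupport (fun hx' => hx (hs hx')), zero_smul]
  rw [lam, Measure.restrict_congr_set Ioo_ae_eq_Icc.symm]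
  refine (ae_restrict_iff' measurableSet_Ioo).2 (key.mono fun x hx hxT => ?_)
  exact sub_eq_zero.1 (hx hxT)

lemma caputoDeriv_spec {α T : ℝ} {v : ℝ → ℝ} (h : ∃ w, HasCaputoDeriv α T v w) :
    HasCaputoDeriv α T v (caputoDeriv α T v) := by
  rw [caputoDeriv, dif_pos h]
  exact h.choose_spec

lemma HasCaputoDeriv.linear {α T : ℝ} (hα : α < 1) {u v w z : ℝ → ℝ}
    (hu : IntegrableOn u (Icc 0 T)) (hv : IntegrableOn v (Icc 0 T))
    (h₁ : HasCaputoDeriv α T u w) (h₂ : HasCaputoDeriv α T v z) (a b : ℝ) :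
    HasCaputoDeriv α T (a • u + b • v) (a • w + b • z) := by
  have hc : ∀ c : ℝ, IntegrableOn (fun _ : ℝ => c) (Icc 0 T) := fun c =>
    integrableOn_const (by simp)
  refine (HasWeakDerivOn.linear h₁ h₂ a b).congr_left ?_
  filter_upwards [rlIntegral_linear_ae (by linarith : 0 < 1 - α) (hu.sub (hc (u 0)))
    (hv.sub (hc (v 0))) a b] with x hx hxT
  have e : (fun t => (a • u + b • v) t - (a • u + b • v) 0) =
      fun t => a * (u t - u 0) + b * (v t - v 0) := by
    ext t; simp; ring
  rw [e]
  exact (hx hxT).symm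

lemma hasCaputoDeriv_zero (α T : ℝ) : HasCaputoDeriv α T 0 0 := by
  have e : rlIntegral (1 - α) (fun t => (0 : ℝ → ℝ) t - (0 : ℝ → ℝ) 0) = fun _ => 0 := by
    ext x; simp [rlIntegral]
  rw [HasCaputoDeriv, e]
  refine ⟨locallyIntegrableOn_const 0, locallyIntegrableOn_const 0, fun φ _ _ _ => by simp⟩

/-! ### The fractional Caputo-derivative Orlicz space -/

/-- Membership in `𝒪^{α,G}([0,T])`: `v` and its Caputo derivative lie in `L^G`. -/
def MemCaputoOrlicz (G : NFunction) (α T : ℝ) (v : ℝ → ℝ) : Prop :=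
  MemOrlicz G (lam T) v ∧ (∃ w, HasCaputoDeriv α T v w) ∧
    MemOrlicz G (lam T) (caputoDeriv α T v)

/-- The modular `ρ_G(v) = ∫_Λ [G(|v|) + G(|ᶜD^α v|)] dx`. -/
def caputoModular (G : NFunction) (α T : ℝ) (v : ℝ → ℝ) : ℝ≥0∞ :=
  ∫⁻ x in Icc 0 T, (ENNReal.ofReal (G |v x|) + ENNReal.ofReal (G |caputoDeriv α T v x|))

/-- The Luxemburg norm `inf {γ > 0 : ρ_G(v / γ) ≤ 1}`. -/
def caputoLuxNorm (G : NFunction) (α T : ℝ) (v : ℝ → ℝ) : ℝ :=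
  sInf {γ : ℝ | 0 < γ ∧ caputoModular G α T (γ⁻¹ • v) ≤ 1}

/-- The sum norm `‖v‖_G + ‖ᶜD^α v‖_G`. -/
def caputoSumNorm (G : NFunction) (α T : ℝ) (v : ℝ → ℝ) : ℝ :=
  luxNorm G (lam T) v + luxNorm G (lam T) (caputoDeriv α T v)

lemma caputoDeriv_linear {G : NFunction} {α T : ℝ} (hα : α < 1) {u v : ℝ → ℝ}
    (hu : MemCaputoOrlicz G α T u) (hv : MemCaputoOrlicz G α T v) (a b : ℝ) :
    caputoDeriv α T (a • u + b • v) =ᵐ[lam T]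
      a • caputoDeriv α T u + b • caputoDeriv α T v := by
  have h := HasCaputoDeriv.linear hα hu.1.integrable hv.1.integrable (caputoDeriv_spec hu.2.1)
    (caputoDeriv_spec hv.2.1) a b
  exact HasWeakDerivOn.unique (caputoDeriv_spec ⟨_, h⟩) h

lemma MemCaputoOrlicz.linear {G : NFunction} {α T : ℝ} (hα : α < 1) {u v : ℝ → ℝ}
    (hu : MemCaputoOrlicz G α T u) (hv : MemCaputoOrlicz G α T v) (a b : ℝ) :
    MemCaputoOrlicz G α T (a • u + b • v) := by
  have hlin : ∀ f g : ℝ → ℝ, MemOrlicz G (lam T) f → MemOrlicz G (lam T) g →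
      MemOrlicz G (lam T) (a • f + b • g) := fun f g hf hg =>
    (orliczSubmodule G (lam T)).add_mem ((orliczSubmodule G (lam T)).smul_mem a hf)
      ((orliczSubmodule G (lam T)).smul_mem b hg)
  exact ⟨hlin u v hu.1 hv.1,
    ⟨_, HasCaputoDeriv.linear hα hu.1.integrable hv.1.integrable (caputoDeriv_spec hu.2.1)
    (caputoDeriv_spec hv.2.1) a b⟩,
    (hlin _ _ hu.2.2 hv.2.2).congr (caputoDeriv_linear hα hu hv a b).symm⟩

lemma caputoDeriv_zero (α T : ℝ) : caputoDeriv α T 0 =ᵐ[lam T] 0 :=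
  HasWeakDerivOn.unique (caputoDeriv_spec ⟨_, hasCaputoDeriv_zero α T⟩) (hasCaputoDeriv_zero α T)

/-- The vector space of all functions in `𝒪^{α,G}([0,T])`. Functions at distance zero from each
other are identified only later, in `NormedOf`. -/
def caputoOrliczSubmodule (G : NFunction) (α T : ℝ) (hα : α ∈ Ioo (0 : ℝ) 1) :
    Submodule ℝ (ℝ → ℝ) :=
  have hz : MemCaputoOrlicz G α T 0 :=
    ⟨(orliczSubmodule G (lam T)).zero_mem, ⟨_, hasCaputoDeriv_zero α T⟩,
      MemOrlicz.congr (orliczSubmodule G (lam T)).zero_mem (caputoDeriv_zero α T).symm⟩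
  { carrier := {v | MemCaputoOrlicz G α T v}
    zero_mem' := hz
    add_mem' := fun {u v} hu hv => by
      have := MemCaputoOrlicz.linear hα.2 hu hv 1 1
      rwa [one_smul, one_smul] at this
    smul_mem' := fun c v hv => by
      have := MemCaputoOrlicz.linear hα.2 hv hv c 0
      rwa [zero_smul, add_zero] at this }

lemma caputoModular_eq (G : NFunction) (α T : ℝ) {v : ℝ → ℝ} (hv : MemCaputoOrlicz G α T v) :
    caputoModular G α T v =
      orliczModular G (lam T) v + orliczModular G (lam T) (caputoDeriv α T v) :=
  lintegral_add_left' (aemeasurable_orlicz G hv.1.1) _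

lemma caputoDeriv_smul {G : NFunction} {α T : ℝ} (hα : α < 1) {v : ℝ → ℝ}
    (hv : MemCaputoOrlicz G α T v) (c : ℝ) :
    caputoDeriv α T (c • v) =ᵐ[lam T] c • caputoDeriv α T v := by
  have := caputoDeriv_linear hα hv hv c 0
  rwa [zero_smul, zero_smul, add_zero, add_zero] at this

/-- The Luxemburg norm of `𝒪^{α,G}` as a seminorm on functions. -/
def caputoLuxSeminorm (G : NFunction) (α T : ℝ) (hα : α ∈ Ioo (0 : ℝ) 1) :
    Seminorm ℝ (caputoOrliczSubmodule G α T hα) :=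
  modularSeminorm (fun v => caputoModular G α T v)
    (by
      rw [caputoModular_eq G α T (0 : caputoOrliczSubmodule G α T hα).2]
      simp only [Submodule.coe_zero]
      rw [orliczModular_congr G (caputoDeriv_zero α T), orliczModular_zero, add_zero])
    (fun v => by
      have h := caputoDeriv_smul hα.2 v.2 (-1)
      rw [neg_one_smul, neg_one_smul] at h
      rw [caputoModular_eq G α T v.2, caputoModular_eq G α T (-v).2]
      simp only [Submodule.coe_neg]
      rw [orliczModular_congr G h, orliczModular_neg, orliczModular_neg])
    (fun u v a b ha hb hab => by
      rw [caputoModular_eq G α T u.2, caputoModular_eq G α T v.2,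
        caputoModular_eq G α T (a • u + b • v).2]
      simp only [Submodule.coe_add, Submodule.coe_smul]
      rw [orliczModular_congr G (caputoDeriv_linear hα.2 u.2 v.2 a b)]
      refine (add_le_add (orliczModular_convex G u.2.1.1 ha hb hab)
        (orliczModular_convex G u.2.2.2.1 ha hb hab)).trans (le_of_eq ?_)
      ring)
    (fun v => by
      obtain ⟨γ₁, h₁, f₁⟩ := (memOrlicz_iff.1 v.2.1).2
      obtain ⟨γ₂, h₂, f₂⟩ := (memOrlicz_iff.1 v.2.2.2).2
      refine ⟨min γ₁ γ₂, lt_min h₁ h₂, ?_⟩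
      rw [caputoModular_eq G α T (min γ₁ γ₂ • v).2]
      simp only [Submodule.coe_smul]
      rw [orliczModular_congr G (caputoDeriv_smul hα.2 v.2 _)]
      exact ENNReal.add_lt_top.2
        ⟨(orliczModular_smul_mono G _ _ (lt_min h₁ h₂).le (min_le_left _ _)).trans_lt f₁,
          (orliczModular_smul_mono G _ _ (lt_min h₁ h₂).le (min_le_right _ _)).trans_lt f₂⟩)

lemma caputoLuxSeminorm_apply (G : NFunction) (α T : ℝ) (hα : α ∈ Ioo (0 : ℝ) 1)
    (v : caputoOrliczSubmodule G α T hα) :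
    caputoLuxSeminorm G α T hα v = caputoLuxNorm G α T v := rfl

/-- The sum norm of `𝒪^{α,G}` as a seminorm on functions. -/
def caputoSumSeminorm (G : NFunction) (α T : ℝ) (hα : α ∈ Ioo (0 : ℝ) 1) :
    Seminorm ℝ (caputoOrliczSubmodule G α T hα) :=
  Seminorm.of (fun v => caputoSumNorm G α T v)
    (fun u v => by
      have h := caputoDeriv_linear hα.2 u.2 v.2 1 1
      rw [one_smul, one_smul, one_smul, one_smul] at h
      simp only [caputoSumNorm, Submodule.coe_add]
      rw [luxNorm_congr G h]
      have h1 := luxNorm_add_le G (lam T) u.2.1 v.2.1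
      have h2 := luxNorm_add_le G (lam T) u.2.2.2 v.2.2.2
      linarith)
    (fun c v => by
      simp only [caputoSumNorm, Submodule.coe_smul]
      rw [luxNorm_congr G (caputoDeriv_smul hα.2 v.2 c), luxNorm_smul G _ v.2.1,
        luxNorm_smul G _ v.2.2.2]
      ring)

lemma caputoSumSeminorm_apply (G : NFunction) (α T : ℝ) (hα : α ∈ Ioo (0 : ℝ) 1)
    (v : caputoOrliczSubmodule G α T hα) :
    caputoSumSeminorm G α T hα v = caputoSumNorm G α T v := rfl

/-- A vector space regarded as a seminormed space through a given seminorm. -/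
def SeminormedOf {V : Type*} [AddCommGroup V] [Module ℝ V] (_p : Seminorm ℝ V) : Type _ := V

instance {V : Type*} [AddCommGroup V] [Module ℝ V] (p : Seminorm ℝ V) :
    SeminormedAddCommGroup (SeminormedOf p) :=
  p.toAddGroupSeminorm.toSeminormedAddCommGroup

instance {V : Type*} [AddCommGroup V] [Module ℝ V] (p : Seminorm ℝ V) :
    NormedSpace ℝ (SeminormedOf p) where
  __ := (inferInstance : Module ℝ V)
  norm_smul_le c v := (map_smul_eq_mul p c v).le

lemma SeminormedOf.norm_def {V : Type*} [AddCommGroup V] [Module ℝ V] (p : Seminorm ℝ V)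
    (v : V) : ‖(show SeminormedOf p from v)‖ = p v := rfl

/-- The normed space obtained from a seminorm by identifying vectors at distance zero. -/
abbrev NormedOf {V : Type*} [AddCommGroup V] [Module ℝ V] (p : Seminorm ℝ V) : Type _ :=
  SeparationQuotient (SeminormedOf p)

/-- The space `𝒪^{α,G}([0,T])` with the norm `inf {γ > 0 : ρ_G(v / γ) ≤ 1}`. -/
abbrev CaputoOrlicz (G : NFunction) (α T : ℝ) (hα : α ∈ Ioo (0 : ℝ) 1) : Type :=
  NormedOf (caputoLuxSeminorm G α T hα)

/-- The space `𝒪^{α,G}([0,T])` with the norm `‖v‖_G + ‖ᶜD^α v‖_G`. -/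
abbrev CaputoOrliczSum (G : NFunction) (α T : ℝ) (hα : α ∈ Ioo (0 : ℝ) 1) : Type :=
  NormedOf (caputoSumSeminorm G α T hα)

/-- Reflexivity: the canonical map into the double dual is onto. -/
def IsReflexiveSpace (E : Type*) [NormedAddCommGroup E] [NormedSpace ℝ E] : Prop :=
  Function.Surjective (NormedSpace.inclusionInDoubleDual ℝ E)

end

/-! The two norms play complementary roles. Uniform convexity is visible for the Luxemburg norm and
is not an isomorphism invariant. Completeness and separability are easier for the sum norm, whose
Cauchy sequences are pairs of Cauchy sequences in `L^G`. The estimate with constants 1 and 2 lets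
completeness, separability and reflexivity cross between the two.

Uniform convexity: since `H s = G (√s)` is convex with `H 0 = 0`, it is superadditive, and the
parallelogram identity gives the Clarkson-type inequality `NFunction.clarkson`. The Caputo
derivative is linear almost everywhere, so the inequality integrates to the modular of `𝒪`. If `u`,
`v` have norm one and are far apart, the modular of `(u - v) / 2` is bounded below, hence that of
`(u + v) / 2` is at most `1 - η`. The `Δ₂`-condition converts such modular bounds into norm bounds
uniformly (`uniformConvexSpace_modularSeminorm`).

Completeness: `L^G` is complete by Fatou along a subsequence, and the Caputo derivative is closed
(`exists_hasCaputoDeriv_update`). The delicate point is the value at `0`, which enters the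
derivative but is invisible to `L^G`. It is recovered from the weak equation, because the
Riemann–Liouville integral of `1` is not weakly constant.

Separability: `v ↦ (v, ᶜD^α v)` embeds `𝒪` in `L^G × L^G`, and `L^G` is separable under `Δ₂` since
bounded functions are dense. Reflexivity of the Luxemburg space is then the Milman–Pettis theorem.
-/

/-! ### The Milman–Pettis theorem -/

/-- Goldstine's theorem for finitely many functionals. -/
lemma mem_closure_image_closedBall {E : Type*} [NormedAddCommGroup E] [NormedSpace ℝ E]
    (F : StrongDual ℝ (StrongDual ℝ E)) (hF : ‖F‖ ≤ 1) (I : Finset (StrongDual ℝ E)) :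
    (fun f : I => F f) ∈
      closure ((fun (x : E) (f : I) => (f : StrongDual ℝ E) x) '' Metric.closedBall 0 1) := by
  classical
  set A : E →ₗ[ℝ] (I → ℝ) := LinearMap.pi fun f : I => ((f : StrongDual ℝ E) : E →ₗ[ℝ] ℝ)
  change _ ∈ closure (A '' Metric.closedBall 0 1)
  by_contra hmem
  obtain ⟨g, u, hg, hu⟩ := geometric_hahn_banach_closed_point
    ((convex_closedBall (0 : E) 1).linear_image A).closure isClosed_closure hmem
  -- The separating functional on the finite-dimensional space is a combination of coordinates,
  -- hence comes from some `h` in the dual. It yields `‖h‖ ≤ u < F h`, against `‖F‖ ≤ 1`.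
  set h : StrongDual ℝ E := ∑ f : I, g (Pi.single f 1) • (f : StrongDual ℝ E)
  have hgs : ∀ y : I → ℝ, g y = ∑ f : I, g (Pi.single f 1) * y f := by
    intro y
    conv_lhs => rw [pi_eq_sum_univ' y]
    rw [map_sum]
    refine Finset.sum_congr rfl fun f _ => ?_
    rw [map_smul, smul_eq_mul, mul_comm]
  have hgA : ∀ x, g (A x) = h x := by
    intro x
    rw [hgs]
    simp [h, A]
  have hgF : g (fun f : I => F f) = F h := by
    rw [hgs]
    simp [h, map_sum]
  have hlt : ∀ x ∈ Metric.closedBall (0 : E) 1, h x < u := fun x hx => by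
    rw [← hgA]
    exact hg _ (subset_closure ⟨x, hx, rfl⟩)
  have hu0 : 0 < u := by simpa using hlt 0 (by simp)
  have hn : ‖h‖ ≤ u := by
    refine ContinuousLinearMap.opNorm_le_of_unit_norm hu0.le fun x hx => ?_
    rw [Real.norm_eq_abs, abs_le]
    have h1 := hlt x (by simp [hx])
    have h2 := hlt (-x) (by simp [hx])
    rw [map_neg] at h2
    exact ⟨by linarith, h1.le⟩
  have h3 : F h ≤ ‖h‖ := by
    refine (le_abs_self _).trans ((F.le_opNorm h).trans ?_)
    exact mul_le_of_le_one_left (norm_nonneg _) hF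
  rw [hgF] at hu
  linarith

/-- The **Milman–Pettis theorem**. -/
theorem isReflexiveSpace_of_uniformConvexSpace (E : Type*) [NormedAddCommGroup E]
    [NormedSpace ℝ E] [UniformConvexSpace E] [CompleteSpace E] : IsReflexiveSpace E := by
  have key : ∀ F : StrongDual ℝ (StrongDual ℝ E), ‖F‖ = 1 →
      ∃ x, NormedSpace.inclusionInDoubleDual ℝ E x = F := by
    intro F hF
    set ev : E → (StrongDual ℝ E → ℝ) := fun x f => f x
    have hcl : (fun f => F f) ∈ closure (ev '' Metric.closedBall 0 1) := by
      refine mem_closure_iff.2 fun o ho hFo => ?_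
      obtain ⟨I, u, hu, hIo⟩ := isOpen_pi_iff.1 ho _ hFo
      obtain ⟨y, hy, x, hx, rfl⟩ := mem_closure_iff.1 (mem_closure_image_closedBall F hF.le I)
        (univ.pi fun f : I => u f) (isOpen_set_pi finite_univ fun f _ => (hu f f.2).1)
        (fun f _ => (hu f f.2).2)
      exact ⟨ev x, hIo fun f hf => hy ⟨f, hf⟩ trivial, x, hx, rfl⟩
    -- `𝓕` describes points of the unit ball tending weakly to `F`; it is nontrivial by Goldstine.
    -- Uniform convexity makes it norm-Cauchy, and its limit represents `F`.
    set 𝓕 : Filter E := comap ev (𝓝 fun f => F f) ⊓ 𝓟 (Metric.closedBall 0 1)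
    have hne : 𝓕.NeBot := by
      refine inf_principal_neBot_iff.2 fun U hU => ?_
      obtain ⟨W, hW, hWU⟩ := mem_comap.1 hU
      obtain ⟨_, hyW, x, hx, rfl⟩ := mem_closure_iff_nhds.1 hcl W hW
      exact ⟨x, hWU hyW, hx⟩
    have hball : Metric.closedBall (0 : E) 1 ∈ 𝓕 := mem_inf_of_right (mem_principal_self _)
    have hlim : ∀ f : StrongDual ℝ E, Tendsto f 𝓕 (𝓝 (F f)) := fun f =>
      tendsto_pi_nhds.1 (tendsto_comap.mono_left inf_le_left : Tendsto ev 𝓕 (𝓝 fun f => F f)) f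
    have hcau : Cauchy 𝓕 := by
      refine Metric.cauchy_iff.2 ⟨hne, fun ε hε => ?_⟩
      obtain ⟨δ, hδ, h⟩ := exists_forall_closed_ball_dist_add_le_two_sub E hε
      -- A functional that almost norms `F`. The bound in the contradiction is a maximum with `0`
      -- because `1 - δ / 2` may be negative.
      obtain ⟨f, hf1, hf⟩ : ∃ f : StrongDual ℝ E, ‖f‖ ≤ 1 ∧ 1 - δ / 2 < F f := by
        by_contra! hcon
        have hM : ‖F‖ ≤ max (1 - δ / 2) 0 := by
          refine ContinuousLinearMap.opNorm_le_of_unit_norm (le_max_right _ _) fun f hf => ?_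
          rw [Real.norm_eq_abs]
          refine le_max_of_le_left (abs_le.2 ⟨?_, hcon f hf.le⟩)
          have := hcon (-f) (by rw [norm_neg, hf])
          rw [map_neg] at this
          linarith
        rw [hF] at hM
        rcases le_max_iff.1 hM with h' | h' <;> linarith
      -- This slice of the ball has small diameter: for `x`, `y` in it, `‖x + y‖ ≥ f (x + y) > 2 -
      -- δ`, so uniform convexity forbids `‖x - y‖ ≥ ε`.
      refine ⟨Metric.closedBall 0 1 ∩ {x | 1 - δ / 2 < f x},
        inter_mem hball ((hlim f).eventually (lt_mem_nhds hf)), fun x hx y hy => ?_⟩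
      by_contra! hxy
      rw [dist_eq_norm] at hxy
      have h1 := h (mem_closedBall_zero_iff.1 hx.1) (mem_closedBall_zero_iff.1 hy.1) hxy
      have h2 : f (x + y) ≤ ‖x + y‖ := (le_abs_self _).trans
        ((f.le_opNorm _).trans (mul_le_of_le_one_left (norm_nonneg _) hf1))
      have h3 : 1 - δ / 2 < f x := hx.2
      have h4 : 1 - δ / 2 < f y := hy.2
      rw [map_add] at h2
      linarith
    obtain ⟨x, hx⟩ := CompleteSpace.complete hcau
    refine ⟨x, ContinuousLinearMap.ext fun f => ?_⟩
    exact tendsto_nhds_unique ((f.continuous.tendsto x).mono_left hx) (hlim f)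
  intro F
  rcases eq_or_ne F 0 with rfl | hF
  · exact ⟨0, map_zero _⟩
  · have hF0 : ‖F‖ ≠ 0 := (norm_ne_zero_iff (E := StrongDual ℝ (StrongDual ℝ E))).2 hF
    obtain ⟨x, hx⟩ := key (‖F‖⁻¹ • F) (by
      simpa using norm_smul_inv_norm (𝕜 := ℝ) (E := StrongDual ℝ (StrongDual ℝ E)) hF)
    refine ⟨‖F‖ • x, ?_⟩
    rw [map_smul, hx, smul_smul, mul_inv_cancel₀ hF0, one_smul]

/-- Reflexivity is invariant under linear homeomorphisms. -/
lemma IsReflexiveSpace.of_equiv {E F : Type*} [NormedAddCommGroup E] [NormedSpace ℝ E]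
    [NormedAddCommGroup F] [NormedSpace ℝ F] (e : E ≃L[ℝ] F) (hE : IsReflexiveSpace E) :
    IsReflexiveSpace F := by
  intro Φ
  -- `Φ` is pulled back to the bidual of `E` along the transpose of `e.symm`; if `x` represents the
  -- result, `e x` represents `Φ`.
  obtain ⟨x, hx⟩ := hE (Φ.comp
    (ContinuousLinearMap.precomp ℝ (e.symm : F →L[ℝ] E) : StrongDual ℝ E →L[ℝ] StrongDual ℝ F))
  refine ⟨e x, ContinuousLinearMap.ext fun f => ?_⟩
  have := DFunLike.congr_fun hx (f.comp (e : E →L[ℝ] F))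
  simp only [NormedSpace.dual_def, ContinuousLinearMap.comp_apply] at this ⊢
  refine this.trans (congrArg Φ ?_)
  ext y
  simp

/-! ### Passing to the separation quotient -/

lemma uniformConvexSpace_separationQuotient (E : Type*) [SeminormedAddCommGroup E]
    [UniformConvexSpace E] : UniformConvexSpace (SeparationQuotient E) := by
  refine ⟨fun ε hε => ?_⟩
  obtain ⟨δ, hδ, h⟩ := exists_forall_sphere_dist_add_le_two_sub E hε
  refine ⟨δ, hδ, ?_⟩
  intro x
  obtain ⟨x, rfl⟩ := SeparationQuotient.surjective_mk x
  intro hx y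
  obtain ⟨y, rfl⟩ := SeparationQuotient.surjective_mk y
  intro hy hxy
  rw [← SeparationQuotient.mk_sub] at hxy
  rw [← SeparationQuotient.mk_add]
  rw [SeparationQuotient.norm_mk] at *
  exact h hx hy hxy

lemma separableSpace_separationQuotient (E : Type*) [TopologicalSpace E]
    [TopologicalSpace.SeparableSpace E] :
    TopologicalSpace.SeparableSpace (SeparationQuotient E) :=
  SeparationQuotient.surjective_mk.denseRange.separableSpace SeparationQuotient.continuous_mk

/-- Mutually bounded seminorms give isomorphic normed spaces. -/
lemma exists_normedOf_equiv {V : Type*} [AddCommGroup V] [Module ℝ V] (p q : Seminorm ℝ V)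
    (C D : ℝ) (hpq : ∀ v, p v ≤ C * q v) (hqp : ∀ v, q v ≤ D * p v) :
    Nonempty (NormedOf p ≃L[ℝ] NormedOf q) := by
  have hmap : ∀ (p q : Seminorm ℝ V) (D : ℝ), (∀ v, q v ≤ D * p v) →
      ∃ f : NormedOf p →L[ℝ] NormedOf q, ∀ v : V,
        f (SeparationQuotient.mk (show SeminormedOf p from v)) =
          SeparationQuotient.mk (show SeminormedOf q from v) := by
    intro p q D h
    let i : SeminormedOf p →L[ℝ] SeminormedOf q := LinearMap.mkContinuous
      { toFun := fun v => (show V from v), map_add' := fun _ _ => rfl, map_smul' := fun _ _ => rfl }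
      D h
    refine ⟨SeparationQuotient.liftCLM ((SeparationQuotient.mkCLM ℝ _).comp i) ?_, fun v => rfl⟩
    intro x y hxy
    exact SeparationQuotient.mk_eq_mk.2 (hxy.map i.continuous)
  obtain ⟨f, hf⟩ := hmap p q D hqp
  obtain ⟨g, hg⟩ := hmap q p C hpq
  refine ⟨ContinuousLinearEquiv.equivOfInverse f g ?_ ?_⟩
  · intro x
    obtain ⟨x, rfl⟩ := SeparationQuotient.surjective_mk x
    exact (congrArg g (hf x)).trans (hg x)
  · intro x
    obtain ⟨x, rfl⟩ := SeparationQuotient.surjective_mk x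
    exact (congrArg f (hg x)).trans (hf x)

/-! ### Luxemburg norms of convex modulars -/

section Modular

variable {V : Type*} [AddCommGroup V] [Module ℝ V] {ρ : V → ℝ≥0∞} {h0 : ρ 0 = 0}
  {hneg : ∀ v, ρ (-v) = ρ v}
  {hconv : ∀ (u v : V) (a b : ℝ), 0 ≤ a → 0 ≤ b → a + b = 1 →
    ρ (a • u + b • v) ≤ ENNReal.ofReal a * ρ u + ENNReal.ofReal b * ρ v}
  {hfin : ∀ v, ∃ γ : ℝ, 0 < γ ∧ ρ (γ • v) < ⊤}

lemma modular_smul_le (h0 : ρ 0 = 0)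
    (hconv : ∀ (u v : V) (a b : ℝ), 0 ≤ a → 0 ≤ b → a + b = 1 →
      ρ (a • u + b • v) ≤ ENNReal.ofReal a * ρ u + ENNReal.ofReal b * ρ v)
    (v : V) {c : ℝ} (hc : 0 ≤ c) (hc1 : c ≤ 1) : ρ (c • v) ≤ ENNReal.ofReal c * ρ v := by
  have := hconv v 0 c (1 - c) hc (by linarith) (by ring)
  simpa [h0] using this

lemma modularSeminorm_le {v : V} {γ : ℝ} (hγ : 0 < γ) (h : ρ (γ⁻¹ • v) ≤ 1) :
    modularSeminorm ρ h0 hneg hconv hfin v ≤ γ :=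
  csInf_le ⟨0, fun _ h => h.1.le⟩ ⟨hγ, h⟩

/-- The strict inequality supplies an admissible scale below `γ`, and convexity with `ρ 0 = 0`
passes from it to `γ`; the infimum itself need not be attained. -/
lemma modular_le_one_of_lt {v : V} {γ : ℝ}
    (h : modularSeminorm ρ h0 hneg hconv hfin v < γ) : ρ (γ⁻¹ • v) ≤ 1 := by
  have hne : {γ : ℝ | 0 < γ ∧ ρ (γ⁻¹ • v) ≤ 1}.Nonempty := by
    obtain ⟨a, ha, hav⟩ := hfin v
    set M := (ρ (a • v)).toReal
    have hM : 0 ≤ M := ENNReal.toReal_nonneg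
    -- With `M` the finite modular of `a • v`, contracting by `(M + 1)⁻¹` brings the modular down to
    -- at most `M / (M + 1)`.
    refine ⟨((M + 1)⁻¹ * a)⁻¹, by positivity, ?_⟩
    rw [inv_inv, mul_smul]
    refine (modular_smul_le h0 hconv _ (by positivity)
      (inv_le_one_of_one_le₀ (by linarith))).trans ?_
    rw [← ENNReal.ofReal_toReal hav.ne, ← ENNReal.ofReal_mul (by positivity)]
    refine ENNReal.ofReal_le_one.2 ?_
    rw [inv_mul_le_iff₀ (by positivity)]
    change M ≤ _
    linarith
  obtain ⟨γ', ⟨hγ', hv⟩, hlt⟩ := exists_lt_of_csInf_lt hne h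
  have hγ : 0 < γ := hγ'.trans hlt
  have e : γ⁻¹ • v = (γ⁻¹ * γ') • (γ'⁻¹ • v) := by
    rw [smul_smul, mul_assoc, mul_inv_cancel₀ hγ'.ne', mul_one]
  have hle : γ⁻¹ * γ' ≤ 1 := by rw [inv_mul_le_iff₀ hγ, mul_one]; exact hlt.le
  rw [e]
  refine (modular_smul_le h0 hconv _ (by positivity) hle).trans ?_
  exact mul_le_one' (ENNReal.ofReal_le_one.2 hle) hv

/-- `(1 + t) • v` lies on the segment from `v` to `2 • v`, so convexity turns the doubling bound
into a growth factor tending to 1 as `t → 0`. -/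
lemma modular_one_add_smul_le
    (hconv : ∀ (u v : V) (a b : ℝ), 0 ≤ a → 0 ≤ b → a + b = 1 →
      ρ (a • u + b • v) ≤ ENNReal.ofReal a * ρ u + ENNReal.ofReal b * ρ v)
    {k : ℝ} (hk : 0 < k) (hΔ : ∀ v, ρ ((2 : ℝ) • v) ≤ ENNReal.ofReal k * ρ v) {v : V} {r t : ℝ}
    (hr : 0 ≤ r) (hv : ρ v ≤ ENNReal.ofReal r) (ht : 0 ≤ t) (ht1 : t ≤ 1) :
    ρ ((1 + t) • v) ≤ ENNReal.ofReal ((1 + t * k) * r) := by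
  have e : (1 + t) • v = (1 - t) • v + t • ((2 : ℝ) • v) := by
    rw [smul_smul, ← add_smul]; congr 1; ring
  rw [e]
  calc _ ≤ _ := hconv _ _ _ _ (by linarith) ht (by ring)
    _ ≤ ENNReal.ofReal (1 - t) * ENNReal.ofReal r
        + ENNReal.ofReal t * (ENNReal.ofReal k * ENNReal.ofReal r) := by
      gcongr
      exact (hΔ v).trans (by gcongr)
    _ = ENNReal.ofReal ((1 - t) * r + t * (k * r)) := by
      rw [← ENNReal.ofReal_mul (by linarith), ← ENNReal.ofReal_mul hk.le,
        ← ENNReal.ofReal_mul ht, ← ENNReal.ofReal_add (mul_nonneg (by linarith) hr)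
        (by positivity)]
    _ ≤ _ := ENNReal.ofReal_le_ofReal (by nlinarith [mul_nonneg ht hr])

/-- Closes the borderline case of `modular_le_one_of_lt` by letting `t → 0`; `Δ₂` takes the place of
a Fatou property of `ρ`. -/
lemma modular_le_one_of_le_one {k : ℝ} (hk : 0 < k)
    (hΔ : ∀ v, ρ ((2 : ℝ) • v) ≤ ENNReal.ofReal k * ρ v) {v : V}
    (hv : modularSeminorm ρ h0 hneg hconv hfin v ≤ 1) : ρ v ≤ 1 := by
  have key : ∀ t ∈ Ioo (0 : ℝ) 1, ρ v ≤ ENNReal.ofReal (1 + t * k) := by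
    intro t ht
    have h1 := modular_le_one_of_lt (lt_of_le_of_lt hv (by linarith [ht.1] : 1 < 1 + t))
    have h2 := modular_one_add_smul_le (v := (1 + t)⁻¹ • v) hconv hk hΔ zero_le_one
      (by simpa using h1) ht.1.le ht.2.le
    rwa [smul_smul, mul_inv_cancel₀ (by linarith [ht.1]), one_smul, mul_one] at h2
  have hlim : Tendsto (fun t : ℝ => ENNReal.ofReal (1 + t * k)) (𝓝[>] 0) (𝓝 1) := by
    have : Continuous fun t : ℝ => ENNReal.ofReal (1 + t * k) :=
      ENNReal.continuous_ofReal.comp (by fun_prop)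
    simpa using (this.tendsto 0).mono_left nhdsWithin_le_nhds
  exact ge_of_tendsto hlim (eventually_of_mem (Ioo_mem_nhdsGT one_pos) key)

lemma exists_modularSeminorm_le_one_sub {k : ℝ} (hk : 0 < k)
    (hΔ : ∀ v, ρ ((2 : ℝ) • v) ≤ ENNReal.ofReal k * ρ v) {η : ℝ} (hη : 0 < η) (hη1 : η ≤ 1) :
    ∃ δ : ℝ, 0 < δ ∧ ∀ v, ρ v ≤ ENNReal.ofReal (1 - η) →
      modularSeminorm ρ h0 hneg hconv hfin v ≤ 1 - δ := by
  -- Chosen so that `t * k ≤ η`, whence `(1 + t * k) * (1 - η) ≤ 1` and `(1 + t) • v` still has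
  -- modular at most one.
  set t := min 1 (η / k)
  have ht : 0 < t := lt_min one_pos (by positivity)
  have htk : t * k ≤ η := by
    rw [← le_div_iff₀ hk]; exact min_le_right _ _
  have hlt : (1 + t)⁻¹ < 1 := inv_lt_one_of_one_lt₀ (by linarith)
  refine ⟨1 - (1 + t)⁻¹, by linarith, fun v hv => ?_⟩
  rw [sub_sub_cancel]
  refine modularSeminorm_le (by positivity) ?_
  rw [inv_inv]
  refine (modular_one_add_smul_le hconv hk hΔ (by linarith) hv ht.le (min_le_left _ _)).trans ?_
  exact ENNReal.ofReal_le_one.2 (by nlinarith [mul_pos ht hk])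

lemma modular_two_pow_smul_le {k : ℝ} (hk : 0 < k)
    (hΔ : ∀ v, ρ ((2 : ℝ) • v) ≤ ENNReal.ofReal k * ρ v) (n : ℕ) (v : V) :
    ρ ((2 ^ n : ℝ) • v) ≤ ENNReal.ofReal (k ^ n) * ρ v := by
  induction n with
  | zero => simp
  | succ n ih =>
    rw [pow_succ', mul_smul]
    refine (hΔ _).trans ?_
    rw [pow_succ', ENNReal.ofReal_mul hk.le, mul_assoc]
    gcongr

/-- With `2⁻ⁿ < ε`, doubling `n` times multiplies the modular by at most `k ^ n`, so `η = (k ^ n)⁻¹`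
works. -/
lemma exists_modularSeminorm_le {k : ℝ} (hk : 0 < k)
    (hΔ : ∀ v, ρ ((2 : ℝ) • v) ≤ ENNReal.ofReal k * ρ v) {ε : ℝ} (hε : 0 < ε) :
    ∃ η : ℝ, 0 < η ∧ ∀ v, ρ v ≤ ENNReal.ofReal η →
      modularSeminorm ρ h0 hneg hconv hfin v ≤ ε := by
  obtain ⟨n, hn⟩ := exists_pow_lt_of_lt_one hε (by norm_num : (2⁻¹ : ℝ) < 1)
  refine ⟨(k ^ n)⁻¹, by positivity, fun v hv => ?_⟩
  refine le_trans (modularSeminorm_le (by positivity) ?_) hn.le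
  rw [← inv_pow, inv_inv]
  refine (modular_two_pow_smul_le hk hΔ n v).trans ((mul_le_mul_right hv _).trans ?_)
  rw [← ENNReal.ofReal_mul (by positivity), mul_inv_cancel₀ (by positivity), ENNReal.ofReal_one]

/-- A modular satisfying the `Δ₂`-condition and a Clarkson-type inequality has a uniformly convex
Luxemburg norm. -/
theorem uniformConvexSpace_modularSeminorm {k : ℝ} (hk : 0 < k)
    (hΔ : ∀ v, ρ ((2 : ℝ) • v) ≤ ENNReal.ofReal k * ρ v)
    (hcl : ∀ u v, ρ ((1 / 2 : ℝ) • (u + v)) + ρ ((1 / 2 : ℝ) • (u - v)) ≤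
      ENNReal.ofReal (1 / 2) * (ρ u + ρ v)) :
    UniformConvexSpace (SeminormedOf (modularSeminorm ρ h0 hneg hconv hfin)) := by
  set p := modularSeminorm ρ h0 hneg hconv hfin
  refine ⟨fun ε hε => ?_⟩
  -- The half-difference has norm at least `ε / 2`; the threshold `ε / 4` lies strictly below it and
  -- leaves a contradiction.
  obtain ⟨η₀, hη₀, hA⟩ := exists_modularSeminorm_le (h0 := h0) (hneg := hneg) (hconv := hconv)
    (hfin := hfin) hk hΔ (by positivity : 0 < ε / 4)
  set η := min η₀ 1
  have hη : 0 < η := lt_min hη₀ one_pos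
  obtain ⟨δ, hδ, hB⟩ := exists_modularSeminorm_le_one_sub (h0 := h0) (hneg := hneg)
    (hconv := hconv) (hfin := hfin) hk hΔ hη (min_le_right _ _)
  have main : ∀ u v : V, p u = 1 → p v = 1 → ε ≤ p (u - v) → p (u + v) ≤ 2 - 2 * δ := by
    intro u v hu hv huv
    have h1 : ρ u ≤ 1 := modular_le_one_of_le_one hk hΔ hu.le
    have h2 : ρ v ≤ 1 := modular_le_one_of_le_one hk hΔ hv.le
    have hhalf : ∀ w, p ((1 / 2 : ℝ) • w) = 1 / 2 * p w := fun w => by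
      rw [map_smul_eq_mul]; norm_num
    have h3 : ENNReal.ofReal η ≤ ρ ((1 / 2 : ℝ) • (u - v)) := by
      by_contra! hlt
      have : p _ ≤ _ := hA _ (hlt.le.trans (ENNReal.ofReal_le_ofReal (min_le_left _ _)))
      rw [hhalf] at this
      linarith
    -- The right side of Clarkson is at most one, so what the half-difference uses up is missing
    -- from the midpoint.
    have h4 : ρ ((1 / 2 : ℝ) • (u + v)) + ENNReal.ofReal η ≤ 1 := by
      refine (add_le_add_right h3 _).trans ((hcl u v).trans ?_)
      calc _ ≤ ENNReal.ofReal (1 / 2) * (1 + 1) := by gcongr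
        _ = 1 := by
          rw [one_add_one_eq_two, ← ENNReal.ofReal_ofNat, ← ENNReal.ofReal_mul (by norm_num)]
          norm_num
    have h5 : p _ ≤ _ := hB ((1 / 2 : ℝ) • (u + v)) (by
      rw [ENNReal.ofReal_sub _ hη.le, ENNReal.ofReal_one]
      exact ENNReal.le_sub_of_add_le_right ENNReal.ofReal_ne_top h4)
    rw [hhalf] at h5
    linarith
  exact ⟨2 * δ, by positivity, fun u hu v hv huv => main u v hu hv huv⟩

end Modular

/-! ### Pointwise inequalities for the `N`-function -/

/-- The squares of `(a + b) / 2` and `(a - b) / 2` add up to `(a² + b²) / 2`. Superadditivity of `H`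
at these squares, then midpoint convexity of `H` at `a²` and `b²`, give the bound. -/
lemma NFunction.clarkson (G : NFunction) (hG : ConvexOn ℝ (Ici 0) (fun s : ℝ => G (√s)))
    (a b : ℝ) : G |1 / 2 * (a + b)| + G |1 / 2 * (a - b)| ≤ 1 / 2 * (G |a| + G |b|) := by
  set H : ℝ → ℝ := fun s => G (√s)
  have hH0 : H 0 = 0 := by simp [H, G.map_zero]
  have hHsq : ∀ c : ℝ, H (c ^ 2) = G |c| := fun c => by simp [H, Real.sqrt_sq_eq_abs]
  have hsuper : ∀ x y, 0 ≤ x → 0 ≤ y → H x + H y ≤ H (x + y) := by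
    intro x y hx hy
    rcases (add_nonneg hx hy).eq_or_lt with hs | hs
    · have hx0 : x = 0 := by linarith
      have hy0 : y = 0 := by linarith
      simp [hx0, hy0, hH0]
    -- Below `x + y` the graph of `H` lies under the chord from the origin; superadditivity is the
    -- sum of two such bounds.
    have hsc : ∀ z, 0 ≤ z → z ≤ x + y → H z ≤ z / (x + y) * H (x + y) := by
      intro z hz hz1
      have := hG.2 (x := x + y) (y := 0) hs.le self_mem_Ici
        (div_nonneg hz hs.le) (sub_nonneg.2 ((div_le_one hs).2 hz1)) (by ring)
      simp only [smul_eq_mul, mul_zero, add_zero, div_mul_cancel₀ _ hs.ne'] at this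
      change H z ≤ _ + _ * H 0 at this
      rwa [hH0, mul_zero, add_zero] at this
    calc _ ≤ x / (x + y) * H (x + y) + y / (x + y) * H (x + y) :=
          add_le_add (hsc x hx (by linarith)) (hsc y hy (by linarith))
      _ = _ := by field_simp
  have h1 := hsuper ((1 / 2 * (a + b)) ^ 2) ((1 / 2 * (a - b)) ^ 2) (sq_nonneg _) (sq_nonneg _)
  have h2 := hG.2 (x := a ^ 2) (y := b ^ 2) (sq_nonneg a) (sq_nonneg b)
    (by norm_num : (0 : ℝ) ≤ 1 / 2) (by norm_num : (0 : ℝ) ≤ 1 / 2) (by norm_num)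
  change H _ ≤ (1 / 2 : ℝ) * H _ + (1 / 2 : ℝ) * H _ at h2
  have e : (1 / 2 * (a + b)) ^ 2 + (1 / 2 * (a - b)) ^ 2
      = (1 / 2 : ℝ) • a ^ 2 + (1 / 2 : ℝ) • b ^ 2 := by
    simp only [smul_eq_mul]; ring
  rw [e, hHsq, hHsq] at h1
  rw [hHsq, hHsq] at h2
  linarith

lemma orliczModular_two_smul_le (G : NFunction) {k : ℝ} (hk : 0 < k)
    (hΔ : ∀ s : ℝ, 0 ≤ s → G (2 * s) ≤ k * G s) (μ : Measure ℝ) (v : ℝ → ℝ) :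
    orliczModular G μ ((2 : ℝ) • v) ≤ ENNReal.ofReal k * orliczModular G μ v := by
  unfold orliczModular
  rw [← lintegral_const_mul' _ _ ENNReal.ofReal_ne_top]
  refine lintegral_mono fun x => ?_
  rw [← ENNReal.ofReal_mul hk.le]
  refine ENNReal.ofReal_le_ofReal ?_
  simpa [abs_mul] using hΔ |v x| (abs_nonneg _)

lemma orliczModular_clarkson (G : NFunction) (hG : ConvexOn ℝ (Ici 0) (fun s : ℝ => G (√s)))
    {μ : Measure ℝ} {u v : ℝ → ℝ} (hu : AEMeasurable u μ) (hv : AEMeasurable v μ) :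
    orliczModular G μ ((1 / 2 : ℝ) • (u + v)) + orliczModular G μ ((1 / 2 : ℝ) • (u - v)) ≤
      ENNReal.ofReal (1 / 2) * (orliczModular G μ u + orliczModular G μ v) := by
  unfold orliczModular
  rw [← lintegral_add_left' (aemeasurable_orlicz G ((hu.add hv).const_smul _)),
    ← lintegral_add_left' (aemeasurable_orlicz G hu),
    ← lintegral_const_mul' _ _ ENNReal.ofReal_ne_top]
  refine lintegral_mono fun x => ?_
  rw [← ENNReal.ofReal_add (G.nonneg (abs_nonneg _)) (G.nonneg (abs_nonneg _)),
    ← ENNReal.ofReal_add (G.nonneg (abs_nonneg _)) (G.nonneg (abs_nonneg _)),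
    ← ENNReal.ofReal_mul (by norm_num)]
  exact ENNReal.ofReal_le_ofReal (G.clarkson hG (u x) (v x))

/-! ### Completeness and separability of Orlicz spaces -/

lemma orliczModular_le_one_of_luxNorm_lt {G : NFunction} {μ : Measure ℝ} {v : ℝ → ℝ}
    (hv : MemOrlicz G μ v) {γ : ℝ} (h : luxNorm G μ v < γ) :
    orliczModular G μ (γ⁻¹ • v) ≤ 1 := by
  have h' : luxSeminorm G μ ⟨v, hv⟩ < γ := by rwa [luxSeminorm_apply]
  exact modular_le_one_of_lt (ρ := fun v : orliczSubmodule G μ => orliczModular G μ v)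
    (v := ⟨v, hv⟩) h'

lemma luxNorm_le_of_orliczModular_le_one {G : NFunction} {μ : Measure ℝ} {v : ℝ → ℝ}
    {γ : ℝ} (hγ : 0 < γ) (h : orliczModular G μ (γ⁻¹ • v) ≤ 1) : luxNorm G μ v ≤ γ := by
  rw [luxNorm_eq]
  exact csInf_le ⟨0, fun _ h => h.1.le⟩ ⟨hγ, h⟩

lemma luxNorm_nonneg (G : NFunction) (μ : Measure ℝ) (v : ℝ → ℝ) : 0 ≤ luxNorm G μ v :=
  Real.sInf_nonneg fun _ h => h.1.le

lemma MemOrlicz.sub {G : NFunction} {μ : Measure ℝ} {u v : ℝ → ℝ} (hu : MemOrlicz G μ u)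
    (hv : MemOrlicz G μ v) : MemOrlicz G μ (u - v) :=
  (orliczSubmodule G μ).sub_mem hu hv

lemma NFunction.exists_le_add (G : NFunction) : ∃ c, 0 ≤ c ∧ ∀ s, 0 ≤ s → s ≤ c + G s := by
  obtain ⟨s₀, hs₀⟩ := eventually_atTop.1
    ((G.tendsto_atTop.eventually_ge_atTop 1).and (eventually_gt_atTop 0))
  refine ⟨|s₀|, abs_nonneg _, fun s hs => ?_⟩
  rcases le_total s₀ s with h | h
  · obtain ⟨h1, h2⟩ := hs₀ s h
    rw [le_div_iff₀ h2] at h1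
    have := abs_nonneg s₀
    linarith
  · have := G.nonneg hs
    have := le_abs_self s₀
    linarith

/-- The embedding `L^G ⊆ L¹`. -/
lemma exists_integral_abs_le_luxNorm (G : NFunction) (μ : Measure ℝ) [IsFiniteMeasure μ] :
    ∃ C, 0 < C ∧ ∀ v, MemOrlicz G μ v → ∫ x, |v x| ∂μ ≤ C * luxNorm G μ v := by
  obtain ⟨c, hc, hcG⟩ := G.exists_le_add
  have hC : 0 < c * μ.real univ + 1 := by positivity
  refine ⟨c * μ.real univ + 1, hC, fun v hv => ?_⟩
  -- The bound `s ≤ c + G s` is applied to `|v| / γ`, whose modular is at most one; afterwards `γ`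
  -- decreases to the norm.
  have key : ∀ γ, luxNorm G μ v < γ → ∫ x, |v x| ∂μ ≤ (c * μ.real univ + 1) * γ := by
    intro γ hγ
    have hγ0 : 0 < γ := (luxNorm_nonneg G μ v).trans_lt hγ
    have h1 := orliczModular_le_one_of_luxNorm_lt hv hγ
    have h2 : ENNReal.ofReal (∫ x, |(γ⁻¹ • v) x| ∂μ) ≤ ENNReal.ofReal (c * μ.real univ + 1) := by
      rw [ofReal_integral_eq_lintegral_ofReal (hv.integrable.smul γ⁻¹).abs
        (Eventually.of_forall fun _ => abs_nonneg _)]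
      calc _ ≤ ∫⁻ x, (ENNReal.ofReal c + ENNReal.ofReal (G |(γ⁻¹ • v) x|)) ∂μ := by
            refine lintegral_mono fun x => ?_
            rw [← ENNReal.ofReal_add hc (G.nonneg (abs_nonneg _))]
            exact ENNReal.ofReal_le_ofReal (hcG _ (abs_nonneg _))
        _ ≤ ENNReal.ofReal c * μ univ + 1 := by
            rw [lintegral_add_left measurable_const, lintegral_const]
            gcongr
            exact h1
        _ = _ := by
            rw [ENNReal.ofReal_add (by positivity) zero_le_one, ENNReal.ofReal_mul hc,
              ENNReal.ofReal_one, measureReal_def, ENNReal.ofReal_toReal (measure_ne_top _ _)]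
    rw [ENNReal.ofReal_le_ofReal_iff hC.le] at h2
    have e : ∫ x, |(γ⁻¹ • v) x| ∂μ = γ⁻¹ * ∫ x, |v x| ∂μ := by
      rw [← integral_const_mul]
      simp [abs_mul, abs_of_pos hγ0]
    rw [e, inv_mul_le_iff₀ hγ0] at h2
    linarith
  have hlim : Tendsto (fun γ => (c * μ.real univ + 1) * γ) (𝓝[>] (luxNorm G μ v))
      (𝓝 ((c * μ.real univ + 1) * luxNorm G μ v)) :=
    (Continuous.tendsto (by fun_prop) _).mono_left nhdsWithin_le_nhds
  exact ge_of_tendsto hlim (eventually_of_mem self_mem_nhdsWithin key)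

/-- Cauchy sequences in `L^G` converge, and their limit is also a limit in `L¹`. -/
lemma exists_luxNorm_limit (G : NFunction) (μ : Measure ℝ) [IsFiniteMeasure μ] (v : ℕ → ℝ → ℝ)
    (hv : ∀ n, MemOrlicz G μ (v n))
    (hc : ∀ ε : ℝ, 0 < ε → ∃ N, ∀ m ≥ N, ∀ n ≥ N, luxNorm G μ (v m - v n) < ε) :
    ∃ f, MemOrlicz G μ f ∧ ∀ ε : ℝ, 0 < ε → ∃ N, ∀ n ≥ N, luxNorm G μ (v n - f) ≤ ε := by
  obtain ⟨C, hC, hCv⟩ := exists_integral_abs_le_luxNorm G μ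
  have hL : ∀ n, MemLp (v n) 1 μ := fun n => memLp_one_iff_integrable.2 (hv n).integrable
  have hcau : CauchySeq fun n => (hL n).toLp (v n) := by
    refine Metric.cauchySeq_iff.2 fun ε hε => ?_
    obtain ⟨N, hN⟩ := hc (ε / C) (by positivity)
    refine ⟨N, fun m hm n hn => ?_⟩
    rw [dist_eq_norm, ← MemLp.toLp_sub, L1.norm_eq_integral_norm]
    have h1 := hCv _ ((hv m).sub (hv n))
    have h2 := (lt_div_iff₀' hC).1 (hN m hm n hn)
    refine lt_of_le_of_lt (le_of_eq (integral_congr_ae ?_)) (h1.trans_lt h2)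
    filter_upwards [((hL m).sub (hL n)).coeFn_toLp] with x hx
    rw [hx, Real.norm_eq_abs]
  obtain ⟨g, hg⟩ := cauchySeq_tendsto_of_complete hcau
  obtain ⟨ns, hns, hae⟩ := (tendstoInMeasure_of_tendsto_Lp hg).exists_seq_tendsto_ae
  have hae' : ∀ᵐ x ∂μ, Tendsto (fun i => v (ns i) x) atTop (𝓝 (g x)) := by
    filter_upwards [hae, ae_all_iff.2 fun n => (hL n).coeFn_toLp] with x hx hx'
    simpa only [hx'] using hx
  have hgm : AEMeasurable g μ := (Lp.aestronglyMeasurable g).aemeasurable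
  have key : ∀ ε : ℝ, 0 < ε → ∃ N, ∀ n ≥ N, orliczModular G μ (ε⁻¹ • (v n - g)) ≤ 1 := by
    intro ε hε
    obtain ⟨N, hN⟩ := hc ε hε
    refine ⟨N, fun n hn => ?_⟩
    -- The `L¹` limit gives an almost everywhere convergent subsequence. Fatou in its index, with
    -- `n` fixed, passes the Cauchy bound to the limit function.
    have hfatou : orliczModular G μ (ε⁻¹ • (v n - g)) ≤
        liminf (fun i => orliczModular G μ (ε⁻¹ • (v n - v (ns i)))) atTop := by
      refine le_trans (le_of_eq (lintegral_congr_ae ?_)) (lintegral_liminf_le' fun i =>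
        aemeasurable_orlicz G (((hv n).1.sub (hv (ns i)).1).const_smul ε⁻¹))
      filter_upwards [hae'] with x hx
      refine (Tendsto.liminf_eq ?_).symm
      refine (ENNReal.continuous_ofReal.comp G.continuous_abs).continuousAt.tendsto.comp ?_
      exact (hx.const_sub (v n x)).const_mul ε⁻¹
    refine hfatou.trans (liminf_le_of_frequently_le' (Eventually.frequently ?_))
    filter_upwards [hns.tendsto_atTop.eventually_ge_atTop N] with i hi
    exact orliczModular_le_one_of_luxNorm_lt ((hv n).sub (hv (ns i))) (hN n hn (ns i) hi)
  refine ⟨g, ?_, fun ε hε => ?_⟩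
  · obtain ⟨N, hN⟩ := key 1 one_pos
    have hmem : MemOrlicz G μ (v N - g) := memOrlicz_iff.2
      ⟨(hv N).1.sub hgm, 1⁻¹, by norm_num, (hN N le_rfl).trans_lt ENNReal.one_lt_top⟩
    have := (hv N).sub hmem
    rwa [sub_sub_cancel] at this
  · obtain ⟨N, hN⟩ := key ε hε
    exact ⟨N, fun n hn => luxNorm_le_of_orliczModular_le_one hε (hN n hn)⟩

/-! ### Consequences of the `Δ₂`-condition and separability of `L^G` -/

lemma orliczModular_lt_top {G : NFunction} (hΔ : G.DeltaTwo) {μ : Measure ℝ} {v : ℝ → ℝ}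
    (hv : MemOrlicz G μ v) : orliczModular G μ v < ⊤ := by
  obtain ⟨k, hk, hΔ⟩ := hΔ
  obtain ⟨-, γ, hγ, hfin⟩ := memOrlicz_iff.1 hv
  obtain ⟨n, hn⟩ := pow_unbounded_of_one_lt γ⁻¹ (by norm_num : (1 : ℝ) < 2)
  have h1 : orliczModular G μ ((1 : ℝ) • v) ≤ orliczModular G μ ((2 ^ n * γ) • v) := by
    refine orliczModular_smul_mono G μ v zero_le_one ?_
    rw [inv_lt_iff_one_lt_mul₀ hγ] at hn
    exact hn.le
  rw [one_smul, mul_smul] at h1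
  refine h1.trans_lt ((modular_two_pow_smul_le hk
    (orliczModular_two_smul_le G hk hΔ μ) n _).trans_lt ?_)
  exact ENNReal.mul_lt_top ENNReal.ofReal_lt_top hfin

lemma exists_luxNorm_le {G : NFunction} (hΔ : G.DeltaTwo) (μ : Measure ℝ) {ε : ℝ} (hε : 0 < ε) :
    ∃ η : ℝ, 0 < η ∧ ∀ v, MemOrlicz G μ v → orliczModular G μ v ≤ ENNReal.ofReal η →
      luxNorm G μ v ≤ ε := by
  obtain ⟨k, hk, hΔ⟩ := hΔ
  obtain ⟨η, hη, h⟩ := exists_modularSeminorm_le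
    (ρ := fun v : orliczSubmodule G μ => orliczModular G μ v) (h0 := orliczModular_zero G μ)
    (hneg := fun v => orliczModular_neg G μ v)
    (hconv := fun u _ _ _ ha hb hab => orliczModular_convex G u.2.1 ha hb hab)
    (hfin := fun v => (memOrlicz_iff.1 v.2).2) hk
    (fun v => orliczModular_two_smul_le G hk hΔ μ v) hε
  refine ⟨η, hη, fun v hv hle => ?_⟩
  rw [← luxSeminorm_apply G μ ⟨v, hv⟩]
  exact h ⟨v, hv⟩ hle

lemma memOrlicz_of_bounded (G : NFunction) {μ : Measure ℝ} [IsFiniteMeasure μ] {v : ℝ → ℝ}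
    (hm : AEMeasurable v μ) {M : ℝ} (hM : ∀ᵐ x ∂μ, |v x| ≤ M) : MemOrlicz G μ v := by
  refine memOrlicz_iff.2 ⟨hm, 1, one_pos, ?_⟩
  rw [one_smul]
  calc orliczModular G μ v ≤ ∫⁻ _, ENNReal.ofReal (G M) ∂μ :=
        lintegral_mono_ae (hM.mono fun x hx =>
          ENNReal.ofReal_le_ofReal (G.mono (abs_nonneg _) hx))
    _ < ⊤ := by
        rw [lintegral_const]
        exact ENNReal.mul_lt_top ENNReal.ofReal_lt_top (measure_lt_top _ _)

/-- On `[0, M]` the convex `G` lies below its chord of slope `G M / M`. Hence on uniformly bounded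
functions `L¹` convergence controls the modular. -/
lemma orliczModular_le_of_bounded (G : NFunction) {μ : Measure ℝ} {v : ℝ → ℝ}
    (hv : Integrable v μ) {M : ℝ} (hM0 : 0 < M) (hM : ∀ᵐ x ∂μ, |v x| ≤ M) :
    orliczModular G μ v ≤ ENNReal.ofReal (G M / M * ∫ x, |v x| ∂μ) := by
  rw [ENNReal.ofReal_mul (div_nonneg (G.nonneg hM0.le) hM0.le),
    ofReal_integral_eq_lintegral_ofReal hv.abs (Eventually.of_forall fun _ => abs_nonneg _),
    ← lintegral_const_mul' _ _ ENNReal.ofReal_ne_top]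
  refine lintegral_mono_ae (hM.mono fun x hx => ?_)
  rw [← ENNReal.ofReal_mul (div_nonneg (G.nonneg hM0.le) hM0.le)]
  refine ENNReal.ofReal_le_ofReal ?_
  have := G.convexOn.2 (x := 0) (y := M) (by simp) hM0.le
    (sub_nonneg.2 ((div_le_one hM0).2 hx)) (by positivity : 0 ≤ |v x| / M) (by ring)
  simp only [smul_eq_mul, mul_zero, zero_add, G.map_zero, div_mul_cancel₀ _ hM0.ne'] at this
  refine this.trans (le_of_eq ?_)
  ring

/-- Under `Δ₂`, truncations converge. -/
lemma tendsto_orliczModular_sub_truncation {G : NFunction} (hΔ : G.DeltaTwo) {μ : Measure ℝ}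
    {v : ℝ → ℝ} (hv : MemOrlicz G μ v) :
    Tendsto (fun n : ℕ => orliczModular G μ (v - {x | |v x| ≤ n}.indicator v)) atTop (𝓝 0) := by
  classical
  have hpt : ∀ (n : ℕ) x, (v - {x | |v x| ≤ n}.indicator v) x = if |v x| ≤ n then 0 else v x := by
    intro n x
    by_cases h : |v x| ≤ n <;> simp [indicator, h]
  have h := tendsto_lintegral_of_dominated_convergence'
    (F := fun (n : ℕ) x => ENNReal.ofReal (G |(v - {x | |v x| ≤ n}.indicator v) x|))
    (f := fun _ => 0) (fun x => ENNReal.ofReal (G |v x|)) (μ := μ) ?_ ?_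
    (orliczModular_lt_top hΔ hv).ne ?_
  · rw [lintegral_zero] at h
    exact h
  · intro n
    refine aemeasurable_orlicz G (hv.1.sub (hv.1.indicator₀ ?_))
    exact nullMeasurableSet_le hv.1.abs aemeasurable_const
  · refine fun n => Eventually.of_forall fun x => ?_
    refine ENNReal.ofReal_le_ofReal (G.mono (abs_nonneg _) ?_)
    rw [hpt]
    split_ifs <;> simp
  · refine Eventually.of_forall fun x => tendsto_const_nhds.congr' ?_
    obtain ⟨N, hN⟩ := exists_nat_ge |v x|
    filter_upwards [eventually_ge_atTop N] with n hn
    rw [hpt, if_pos (hN.trans (by exact_mod_cast hn)), abs_zero, G.map_zero, ENNReal.ofReal_zero]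

/-- The functions bounded by `n` form a separable subset of `L¹`. Their inclusion into `L^G` is
continuous by the chord bound and `Δ₂`, and truncation makes the union over `n` dense. -/
theorem separableSpace_orlicz {G : NFunction} (hΔ : G.DeltaTwo) (μ : Measure ℝ)
    [IsFiniteMeasure μ] :
    TopologicalSpace.SeparableSpace (SeminormedOf (luxSeminorm G μ)) := by
  let S : ℕ → Set (Lp ℝ 1 μ) := fun n => {f | ∀ᵐ x ∂μ, |f x| ≤ n}
  have hmem : ∀ n, ∀ f : S n, MemOrlicz G μ (f : Lp ℝ 1 μ) := fun n f =>
    memOrlicz_of_bounded G (Lp.aestronglyMeasurable _).aemeasurable f.2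
  let Φ : ∀ n, S n → SeminormedOf (luxSeminorm G μ) := fun n f =>
    (show orliczSubmodule G μ from ⟨_, hmem n f⟩)
  have hdist : ∀ (a b : orliczSubmodule G μ), dist (show SeminormedOf (luxSeminorm G μ) from a)
      (show SeminormedOf (luxSeminorm G μ) from b) = luxNorm G μ (a - b : ℝ → ℝ) := fun a b =>
    (dist_eq_norm _ _).trans (luxSeminorm_apply G μ (a - b))
  have hcont : ∀ n, Continuous (Φ n) := by
    intro n
    refine Metric.continuous_iff.2 fun f ε hε => ?_
    obtain ⟨η, hη, hle⟩ := exists_luxNorm_le hΔ μ (half_pos hε)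
    -- Differences of functions bounded by `n` are bounded by `2 * n`; the extra 1 keeps `M`
    -- positive when `n = 0`.
    set M : ℝ := 2 * n + 1
    have hM : 0 < M := by positivity
    have hGM : 0 < G M / M := div_pos (G.pos M hM) hM
    refine ⟨η / (G M / M), by positivity, fun g hg => ?_⟩
    rw [hdist]
    refine lt_of_le_of_lt (hle _ ((hmem n g).sub (hmem n f)) ?_) (half_lt_self hε)
    have hb : ∀ᵐ x ∂μ, |((g : Lp ℝ 1 μ) - (f : Lp ℝ 1 μ) : ℝ → ℝ) x| ≤ M := by
      filter_upwards [g.2, f.2] with x h1 h2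
      have := abs_sub ((g : Lp ℝ 1 μ) x) ((f : Lp ℝ 1 μ) x)
      simp only [Pi.sub_apply, M]
      linarith
    refine (orliczModular_le_of_bounded G
      ((hmem n g).sub (hmem n f)).integrable hM hb).trans (ENNReal.ofReal_le_ofReal ?_)
    rw [Subtype.dist_eq, dist_eq_norm, L1.norm_eq_integral_norm, lt_div_iff₀' hGM] at hg
    refine le_trans (le_of_eq ?_) hg.le
    congr 1
    refine integral_congr_ae ?_
    filter_upwards [Lp.coeFn_sub (g : Lp ℝ 1 μ) (f : Lp ℝ 1 μ)] with x hx
    rw [hx, Real.norm_eq_abs]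
  have : Fact ((1 : ℝ≥0∞) ≠ ⊤) := ⟨ENNReal.one_ne_top⟩
  have hsep : TopologicalSpace.IsSeparable (closure (⋃ n, range (Φ n))) :=
    (TopologicalSpace.IsSeparable.iUnion fun n =>
      TopologicalSpace.isSeparable_range (hcont n)).closure
  refine TopologicalSpace.isSeparable_univ_iff.1 (hsep.mono fun v _ => ?_)
  obtain ⟨v, hv⟩ : orliczSubmodule G μ := v
  refine Metric.mem_closure_iff.2 fun ε hε => ?_
  obtain ⟨η, hη, hle⟩ := exists_luxNorm_le hΔ μ (half_pos hε)
  obtain ⟨n, hn⟩ := ((tendsto_orliczModular_sub_truncation hΔ hv).eventually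
    (gt_mem_nhds (ENNReal.ofReal_pos.2 hη))).exists
  set w := {x | |v x| ≤ n}.indicator v
  have hwb : ∀ x, |w x| ≤ n := by
    intro x
    by_cases h : |v x| ≤ n <;> simp [w, h]
  have hwm : AEMeasurable w μ :=
    hv.1.indicator₀ (nullMeasurableSet_le hv.1.abs aemeasurable_const)
  have hwO : MemOrlicz G μ w := memOrlicz_of_bounded G hwm (Eventually.of_forall hwb)
  have hwL : MemLp w 1 μ := memLp_one_iff_integrable.2 hwO.integrable
  have hwS : hwL.toLp w ∈ S n := by
    filter_upwards [hwL.coeFn_toLp] with x hx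
    rw [hx]
    exact hwb x
  refine ⟨_, mem_iUnion.2 ⟨n, ⟨_, hwS⟩, rfl⟩, ?_⟩
  refine lt_of_le_of_lt ?_ (half_lt_self hε)
  refine (hdist _ _).le.trans ?_
  refine le_trans (le_of_eq (luxNorm_congr G ?_)) (hle _ (hv.sub hwO) hn.le)
  filter_upwards [hwL.coeFn_toLp] with x hx
  simp only [Pi.sub_apply, hx]

open scoped Convolution

/-! ### The Riemann–Liouville integral on `L¹` -/

/-- The Riemann–Liouville integral is bounded on `L¹(0, T)`. -/
lemma exists_integral_abs_rlIntegral_le {β : ℝ} (hβ : 0 < β) (T : ℝ) :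
    ∃ C, ∀ f, IntegrableOn f (Icc 0 T) → IntegrableOn (rlIntegral β f) (Ioo 0 T) ∧
      ∫ x in Ioo 0 T, |rlIntegral β f x| ≤ C * ∫ x in Icc 0 T, |f x| := by
  rcases le_or_gt T 0 with hT | hT
  · refine ⟨0, fun f _ => ?_⟩
    simp [Ioo_eq_empty (not_lt.2 hT)]
  -- On `(0, T)` the Riemann–Liouville integral is a convolution of functions cut off to `[0, T]`
  -- and `(0, T]`, so the estimate is Young's inequality in `L¹`.
  set K : ℝ → ℝ := (Ioc 0 T).indicator fun t => t ^ (β - 1)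
  have hK : Integrable K := by
    refine (integrable_indicator_iff measurableSet_Ioc).2 ?_
    have := intervalIntegral.intervalIntegrable_rpow' (a := 0) (b := T)
      (by linarith : -1 < β - 1)
    rwa [intervalIntegrable_iff_integrableOn_Ioc_of_le hT.le] at this
  refine ⟨|(Real.Gamma β)⁻¹| * ∫ t, |K t|, fun f hf => ?_⟩
  set F : ℝ → ℝ := (Icc 0 T).indicator f
  have hF : Integrable F := (integrable_indicator_iff measurableSet_Icc).2 hf
  have hFK : Integrable (F ⋆[ContinuousLinearMap.mul ℝ ℝ, volume] K) :=
    hF.integrable_convolution _ hK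
  have hFKa : Integrable ((fun t => |F t|) ⋆[ContinuousLinearMap.mul ℝ ℝ, volume]
      (fun t => |K t|)) := hF.abs.integrable_convolution _ hK.abs
  have heq : ∀ x ∈ Ioo 0 T, rlIntegral β f x =
      (Real.Gamma β)⁻¹ * (F ⋆[ContinuousLinearMap.mul ℝ ℝ, volume] K) x := by
    intro x hx
    rw [rlIntegral, convolution_def, intervalIntegral.integral_of_le hx.1.le,
      integral_Ioc_eq_integral_Ioo, ← integral_indicator measurableSet_Ioo]
    congr 1
    refine integral_congr_ae ?_
    filter_upwards [Measure.ae_ne volume (0 : ℝ)] with t ht0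
    rw [ContinuousLinearMap.mul_apply']
    by_cases ht : t ∈ Ioo 0 x
    · have h1 : t ∈ Icc 0 T := ⟨ht.1.le, (ht.2.trans hx.2).le⟩
      have h2 : x - t ∈ Ioc 0 T := ⟨by linarith [ht.2], by linarith [ht.1, hx.2]⟩
      simp [F, K, indicator_of_mem ht, indicator_of_mem h1, indicator_of_mem h2]
    · rw [indicator_of_notMem ht]
      rcases lt_or_ge t 0 with h | h
      · have h1 : t ∉ Icc 0 T := fun h' => absurd h'.1 (not_le.2 h)
        simp [F, indicator_of_notMem h1]
      · have h2 : x - t ∉ Ioc 0 T := fun h' =>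
          ht ⟨lt_of_le_of_ne h (Ne.symm ht0), by linarith [h'.1]⟩
        simp [K, indicator_of_notMem h2]
  constructor
  · exact ((hFK.const_mul _).integrableOn (s := Ioo 0 T)).congr_fun
      (fun x hx => (heq x hx).symm) measurableSet_Ioo
  · have hle : ∀ x, |(F ⋆[ContinuousLinearMap.mul ℝ ℝ, volume] K) x| ≤
        ((fun t => |F t|) ⋆[ContinuousLinearMap.mul ℝ ℝ, volume] (fun t => |K t|)) x := by
      intro x
      refine (norm_integral_le_integral_norm
        fun t => ContinuousLinearMap.mul ℝ ℝ (F t) (K (x - t))).trans (le_of_eq ?_)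
      simp [convolution_def]
    calc ∫ x in Ioo 0 T, |rlIntegral β f x|
        = ∫ x in Ioo 0 T, |(Real.Gamma β)⁻¹| *
            |(F ⋆[ContinuousLinearMap.mul ℝ ℝ, volume] K) x| :=
          setIntegral_congr_fun measurableSet_Ioo fun x hx => by
            simp only [heq x hx, abs_mul]
      _ = |(Real.Gamma β)⁻¹| *
            ∫ x in Ioo 0 T, |(F ⋆[ContinuousLinearMap.mul ℝ ℝ, volume] K) x| :=
          integral_const_mul _ _
      _ ≤ |(Real.Gamma β)⁻¹| *
            ∫ x, |(F ⋆[ContinuousLinearMap.mul ℝ ℝ, volume] K) x| := by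
          exact mul_le_mul_of_nonneg_left (setIntegral_le_integral hFK.abs
            (Eventually.of_forall fun _ => abs_nonneg _)) (abs_nonneg _)
      _ ≤ |(Real.Gamma β)⁻¹| * ∫ x, ((fun t => |F t|) ⋆[ContinuousLinearMap.mul ℝ ℝ, volume]
            (fun t => |K t|)) x := by
          exact mul_le_mul_of_nonneg_left (integral_mono hFK.abs hFKa hle) (abs_nonneg _)
      _ = |(Real.Gamma β)⁻¹| * ((∫ t, |F t|) * ∫ t, |K t|) := by
          rw [integral_convolution _ hF.abs hK.abs, ContinuousLinearMap.mul_apply']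
      _ = _ := by
          have : (fun t => |F t|) = (Icc 0 T).indicator fun t => |f t| := by
            ext t
            by_cases ht : t ∈ Icc 0 T <;> simp [F, ht, indicator]
          rw [this, integral_indicator measurableSet_Icc]
          ring

lemma rlIntegral_one {β x : ℝ} (hβ : 0 < β) :
    rlIntegral β (fun _ => 1) x = (Real.Gamma β)⁻¹ * (x ^ β / β) := by
  rw [rlIntegral]
  congr 1
  have := intervalIntegral.integral_comp_sub_left (fun t : ℝ => t ^ (β - 1)) x
    (a := 0) (b := x)
  simp only [one_mul]
  rw [this, sub_self, sub_zero, integral_rpow (Or.inl (by linarith))]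
  simp [Real.zero_rpow hβ.ne']

/-- The Riemann–Liouville integral of `1` is not weakly constant. -/
lemma exists_integral_rlIntegral_one_mul_deriv_ne_zero {β T : ℝ} (hβ : 0 < β) (hT : 0 < T) :
    ∃ φ : ℝ → ℝ, ContDiff ℝ ∞ φ ∧ HasCompactSupport φ ∧ tsupport φ ⊆ Ioo 0 T ∧
      ∫ x in Ioo 0 T, rlIntegral β (fun _ => 1) x * deriv φ x ≠ 0 := by
  -- The outer radius `T / 4` keeps the support away from `0`, where `x ^ (β - 1)` may be singular.
  let φ : ContDiffBump (T / 2) := ⟨T / 8, T / 4, by positivity, by linarith⟩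
  have hts : tsupport φ = Icc (T / 4) (3 * T / 4) := by
    rw [φ.tsupport_eq, Real.closedBall_eq_Icc]
    congr 1 <;> (simp only [φ]; ring)
  have hsub : Icc (T / 4) (3 * T / 4) ⊆ Ioo 0 T := fun x hx =>
    ⟨by linarith [hx.1], by linarith [hx.2]⟩
  have hle : T / 4 ≤ 3 * T / 4 := by linarith
  have hcd : ContDiff ℝ ∞ φ := φ.contDiff
  refine ⟨φ, hcd, φ.hasCompactSupport, hts ▸ hsub, ?_⟩
  have hφa : φ (T / 4) = 0 := φ.zero_of_le_dist (by
    rw [Real.dist_eq, abs_of_nonpos (by linarith)]; simp only [φ]; linarith)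
  have hφb : φ (3 * T / 4) = 0 := φ.zero_of_le_dist (by
    rw [Real.dist_eq, abs_of_nonneg (by linarith)]; simp only [φ]; linarith)
  have hφpos : ∀ x ∈ Ioo (T / 4) (3 * T / 4), 0 < φ x := fun x hx => φ.pos_of_mem_ball (by
    rw [Real.ball_eq_Ioo]
    exact ⟨by simp only [φ]; linarith [hx.1], by simp only [φ]; linarith [hx.2]⟩)
  have hpos : ∀ x ∈ uIcc (T / 4) (3 * T / 4), 0 < x := fun x hx => by
    rw [uIcc_of_le hle] at hx
    linarith [hx.1]
  have hc' : ContinuousOn (fun x : ℝ => β * x ^ (β - 1)) (uIcc (T / 4) (3 * T / 4)) := by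
    refine continuousOn_const.mul fun x hx => ?_
    exact (Real.continuousAt_rpow_const _ _ (Or.inl (hpos x hx).ne')).continuousWithinAt
  -- The boundary terms vanish, leaving minus the integral of `β * x ^ (β - 1) * φ x`, which is
  -- strictly positive inside.
  have hibp := intervalIntegral.integral_mul_deriv_eq_deriv_mul (a := T / 4) (b := 3 * T / 4)
    (u := fun x => x ^ β) (u' := fun x => β * x ^ (β - 1)) (v := φ) (v' := deriv φ)
    (fun x hx => Real.hasDerivAt_rpow_const (Or.inl (hpos x hx).ne'))
    (fun x _ => ((hcd.differentiable (by simp)) x).hasDerivAt)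
    hc'.intervalIntegrable ((hcd.continuous_deriv (by simp)).intervalIntegrable _ _)
  have hint : 0 < ∫ x in (T / 4)..(3 * T / 4), β * x ^ (β - 1) * φ x := by
    refine intervalIntegral.intervalIntegral_pos_of_pos_on
      (hc'.mul hcd.continuous.continuousOn).intervalIntegrable (fun x hx => ?_) (by linarith)
    have hx0 : 0 < x := by linarith [hx.1]
    have := hφpos x hx
    positivity
  rw [hφa, hφb] at hibp
  have hrestr : ∫ x in Ioo 0 T, rlIntegral β (fun _ => 1) x * deriv φ x =
      ∫ x in Icc (T / 4) (3 * T / 4), rlIntegral β (fun _ => 1) x * deriv φ x := by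
    refine setIntegral_eq_of_subset_of_forall_sdiff_eq_zero measurableSet_Ioo hsub fun x hx => ?_
    have : deriv φ x = 0 := by
      by_contra h
      exact hx.2 (hts ▸ support_deriv_subset h)
    rw [this, mul_zero]
  rw [hrestr, integral_Icc_eq_integral_Ioc, ← intervalIntegral.integral_of_le hle]
  have e : ∀ x, rlIntegral β (fun _ => 1) x * deriv φ x =
      ((Real.Gamma β)⁻¹ / β) * (x ^ β * deriv φ x) := fun x => by
    rw [rlIntegral_one hβ]; ring
  simp only [e]
  rw [intervalIntegral.integral_const_mul, hibp]
  have hΓ : 0 < (Real.Gamma β)⁻¹ / β := div_pos (inv_pos.2 (Real.Gamma_pos_of_pos hβ)) hβ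
  refine mul_ne_zero hΓ.ne' ?_
  linarith [hint]

lemma tendsto_integral_mul_of_tendsto_integral_abs {X : Type*} [MeasurableSpace X]
    {μ : Measure X} {h : ℕ → X → ℝ} {g ψ : X → ℝ} (hh : ∀ n, Integrable (h n) μ)
    (hg : Integrable g μ) (hψ : AEStronglyMeasurable ψ μ) {B : ℝ} (hB : ∀ x, |ψ x| ≤ B)
    (hlim : Tendsto (fun n => ∫ x, |h n x - g x| ∂μ) atTop (𝓝 0)) :
    Tendsto (fun n => ∫ x, h n x * ψ x ∂μ) atTop (𝓝 (∫ x, g x * ψ x ∂μ)) := by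
  have hB' : ∀ᵐ x ∂μ, ‖ψ x‖ ≤ B := Eventually.of_forall hB
  rw [tendsto_iff_norm_sub_tendsto_zero]
  refine squeeze_zero (fun _ => norm_nonneg _) (fun n => ?_) (by simpa using hlim.const_mul B)
  rw [← integral_sub ((hh n).mul_bdd hψ hB') (hg.mul_bdd hψ hB'), ← integral_const_mul]
  refine norm_integral_le_of_norm_le (((hh n).sub hg).abs.const_mul B)
    (Eventually.of_forall fun x => ?_)
  rw [← sub_mul, norm_mul, mul_comm]
  exact mul_le_mul_of_nonneg_right (hB x) (abs_nonneg _)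

/-! ### Completeness, separability and uniform convexity of `𝒪^{α,G}` -/

lemma lam_eq_restrict_Ioo (T : ℝ) : lam T = volume.restrict (Ioo 0 T) :=
  Measure.restrict_congr_set Ioo_ae_eq_Icc.symm

lemma integrableOn_Ioo_of_lam {T : ℝ} {f : ℝ → ℝ} (hf : Integrable f (lam T)) :
    IntegrableOn f (Ioo 0 T) := by
  rwa [lam_eq_restrict_Ioo] at hf

lemma exists_bound_of_hasCompactSupport {ψ : ℝ → ℝ} (hψ : Continuous ψ)
    (hc : HasCompactSupport ψ) : ∃ B, ∀ x, |ψ x| ≤ B :=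
  hc.exists_bound_of_continuous hψ

/-- The pairing of the Riemann–Liouville integral of `f - c` with a test function. -/
lemma integral_rlIntegral_sub_const_mul {β T : ℝ} (hβ : 0 < β) {f ψ : ℝ → ℝ}
    (hf : IntegrableOn f (Icc 0 T)) (hψ : Continuous ψ) (hc : HasCompactSupport ψ) (c : ℝ) :
    ∫ x in Ioo 0 T, rlIntegral β (fun t => f t - c) x * ψ x =
      (∫ x in Ioo 0 T, rlIntegral β f x * ψ x) -
        c * ∫ x in Ioo 0 T, rlIntegral β (fun _ => 1) x * ψ x := by
  obtain ⟨B, hB⟩ := exists_bound_of_hasCompactSupport hψ hc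
  obtain ⟨C, hC⟩ := exists_integral_abs_rlIntegral_le hβ T
  have h1 : IntegrableOn (fun _ : ℝ => (1 : ℝ)) (Icc 0 T) := integrableOn_const (by simp)
  have hB' : ∀ᵐ x ∂(volume.restrict (Ioo 0 T)), ‖ψ x‖ ≤ B := Eventually.of_forall hB
  have hψm := hψ.aestronglyMeasurable (μ := volume.restrict (Ioo 0 T))
  have i1 := (hC f hf).1.mul_bdd hψm hB'
  have i2 := (hC _ h1).1.mul_bdd hψm hB'
  rw [← integral_const_mul, ← integral_sub i1 (i2.const_mul c)]
  refine integral_congr_ae ((ae_restrict_iff' measurableSet_Ioo).2 ?_)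
  filter_upwards [rlIntegral_linear_ae hβ hf h1 1 (-c)] with x hx hxT
  have e : (fun t => f t - c) = fun t => 1 * f t + -c * 1 := by ext t; ring
  rw [e, hx hxT]
  ring

/-- The Caputo derivative is closed: if `v n → f` and `ᶜD^α (v n) → w` in `L¹`, then `w` is the
Caputo derivative of `f` for a suitable choice of the value `f 0`. -/
lemma exists_hasCaputoDeriv_update {α T : ℝ} (hα : α < 1) (hT : 0 < T) {v w : ℕ → ℝ → ℝ}
    {f z : ℝ → ℝ} (hv : ∀ n, Integrable (v n) (lam T)) (hw : ∀ n, Integrable (w n) (lam T))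
    (hf : Integrable f (lam T)) (hz : Integrable z (lam T))
    (hD : ∀ n, HasCaputoDeriv α T (v n) (w n))
    (hvf : Tendsto (fun n => ∫ x, |v n x - f x| ∂(lam T)) atTop (𝓝 0))
    (hwz : Tendsto (fun n => ∫ x, |w n x - z x| ∂(lam T)) atTop (𝓝 0)) :
    ∃ c, HasCaputoDeriv α T (Function.update f 0 c) z := by
  have hβ : 0 < 1 - α := by linarith
  obtain ⟨C, hC⟩ := exists_integral_abs_rlIntegral_le hβ T
  set J : (ℝ → ℝ) → (ℝ → ℝ) → ℝ := fun f φ =>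
    ∫ x in Ioo 0 T, rlIntegral (1 - α) f x * deriv φ x
  set one : ℝ → ℝ := fun _ => 1
  have hrl : Tendsto (fun n => ∫ x in Ioo 0 T,
      |rlIntegral (1 - α) (v n) x - rlIntegral (1 - α) f x|) atTop (𝓝 0) := by
    refine squeeze_zero (fun _ => integral_nonneg fun _ => abs_nonneg _) (fun n => ?_)
      (by simpa using hvf.const_mul C)
    refine le_trans (le_of_eq ?_) (hC _ ((hv n).sub hf)).2
    refine integral_congr_ae ((ae_restrict_iff' measurableSet_Ioo).2 ?_)
    filter_upwards [rlIntegral_linear_ae hβ (hv n) hf 1 (-1)] with x hx hxT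
    have e : (v n - f) = fun t => 1 * v n t + -1 * f t := by ext t; simp; ring
    rw [e, hx hxT]
    congr 1
    ring
  have hJ : ∀ φ : ℝ → ℝ, ContDiff ℝ ∞ φ → HasCompactSupport φ →
      Tendsto (fun n => J (v n) φ) atTop (𝓝 (J f φ)) := by
    intro φ hφ hc
    have hd : Continuous (deriv φ) := hφ.continuous_deriv (by simp)
    obtain ⟨B, hB⟩ := exists_bound_of_hasCompactSupport hd hc.deriv
    exact tendsto_integral_mul_of_tendsto_integral_abs (fun n => (hC _ (hv n)).1) (hC _ hf).1
      hd.aestronglyMeasurable hB hrl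
  rw [lam_eq_restrict_Ioo] at hwz
  have hW : ∀ φ : ℝ → ℝ, ContDiff ℝ ∞ φ → HasCompactSupport φ →
      Tendsto (fun n => ∫ x in Ioo 0 T, w n x * φ x) atTop (𝓝 (∫ x in Ioo 0 T, z x * φ x)) := by
    intro φ hφ hc
    obtain ⟨B, hB⟩ := exists_bound_of_hasCompactSupport hφ.continuous hc
    exact tendsto_integral_mul_of_tendsto_integral_abs (fun n => integrableOn_Ioo_of_lam (hw n))
      (integrableOn_Ioo_of_lam hz) hφ.continuous.aestronglyMeasurable hB hwz
  have hid : ∀ n, ∀ φ : ℝ → ℝ, ContDiff ℝ ∞ φ → HasCompactSupport φ → tsupport φ ⊆ Ioo 0 T →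
      J (v n) φ - v n 0 * J one φ = -∫ x in Ioo 0 T, w n x * φ x := by
    intro n φ hφ hc hs
    rw [← (hD n).2.2 φ hφ hc hs]
    exact (integral_rlIntegral_sub_const_mul hβ (hv n) (hφ.continuous_deriv (by simp))
      hc.deriv _).symm
  obtain ⟨φ₀, h₁, h₂, h₃, h₄⟩ := exists_integral_rlIntegral_one_mul_deriv_ne_zero hβ hT
  change J one φ₀ ≠ 0 at h₄
  -- The identity `hid`, tested on `φ₀` and solved for `v n 0`, has a convergent right side. Thus
  -- the values at `0` converge although `L¹` does not see them, and their limit is the right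
  -- initial value.
  set c := (J f φ₀ + ∫ x in Ioo 0 T, z x * φ₀ x) / J one φ₀
  have hc0 : Tendsto (fun n => v n 0) atTop (𝓝 c) := by
    refine (((hJ φ₀ h₁ h₂).add (hW φ₀ h₁ h₂)).div_const (J one φ₀)).congr fun n => ?_
    rw [div_eq_iff h₄]
    linarith [hid n φ₀ h₁ h₂ h₃]
  have hupd : Integrable (Function.update f 0 c) (lam T) := by
    refine hf.congr ?_
    filter_upwards [ae_restrict_of_ae (Measure.ae_ne volume (0 : ℝ))] with x hx
    rw [Function.update_of_ne hx]
  have hupd' : ∀ φ, J (Function.update f 0 c) φ = J f φ := by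
    intro φ
    refine integral_congr_ae (Eventually.of_forall fun x => ?_)
    -- Changing `f` at the single point `0` alters no Riemann–Liouville integral; it only changes
    -- the constant subtracted.
    simp only [rlIntegral]
    congr 2
    refine intervalIntegral.integral_congr_ae ?_
    filter_upwards [Measure.ae_ne volume (0 : ℝ)] with t ht _
    rw [Function.update_of_ne ht]
  refine ⟨c, ?_, ?_, fun φ hφ hc hs => ?_⟩
  · rw [Function.update_self]
    exact (hC _ (hupd.sub (integrable_const c))).1.locallyIntegrableOn
  · exact (integrableOn_Ioo_of_lam hz).locallyIntegrableOn
  · rw [Function.update_self]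
    refine (integral_rlIntegral_sub_const_mul hβ hupd (hφ.continuous_deriv (by simp))
      hc.deriv c).trans ?_
    change J (Function.update f 0 c) φ - c * J one φ = _
    rw [hupd']
    refine tendsto_nhds_unique ((hJ φ hφ hc).sub (hc0.mul_const (J one φ))) ?_
    exact (hW φ hφ hc).neg.congr fun n => (hid n φ hφ hc hs).symm

lemma tendsto_integral_abs_of_luxNorm {G : NFunction} {μ : Measure ℝ} [IsFiniteMeasure μ]
    {v : ℕ → ℝ → ℝ} {f : ℝ → ℝ} (hv : ∀ n, MemOrlicz G μ (v n)) (hf : MemOrlicz G μ f)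
    (h : ∀ ε : ℝ, 0 < ε → ∃ N, ∀ n ≥ N, luxNorm G μ (v n - f) ≤ ε) :
    Tendsto (fun n => ∫ x, |v n x - f x| ∂μ) atTop (𝓝 0) := by
  obtain ⟨C, hC, hCv⟩ := exists_integral_abs_le_luxNorm G μ
  have hl : Tendsto (fun n => luxNorm G μ (v n - f)) atTop (𝓝 0) := by
    refine Metric.tendsto_atTop.2 fun ε hε => ?_
    obtain ⟨N, hN⟩ := h (ε / 2) (half_pos hε)
    refine ⟨N, fun n hn => ?_⟩
    rw [Real.dist_eq, sub_zero, abs_of_nonneg (luxNorm_nonneg _ _ _)]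
    linarith [hN n hn]
  exact squeeze_zero (fun _ => integral_nonneg fun _ => abs_nonneg _)
    (fun n => hCv (v n - f) ((hv n).sub hf)) (by simpa using hl.const_mul C)

lemma caputoDeriv_sub {G : NFunction} {α T : ℝ} (hα : α < 1) {u v : ℝ → ℝ}
    (hu : MemCaputoOrlicz G α T u) (hv : MemCaputoOrlicz G α T v) :
    caputoDeriv α T (u - v) =ᵐ[lam T] caputoDeriv α T u - caputoDeriv α T v := by
  have h := caputoDeriv_linear hα hu hv 1 (-1)
  rwa [one_smul, one_smul, neg_one_smul, neg_one_smul, ← sub_eq_add_neg, ← sub_eq_add_neg] at h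

lemma dist_caputoSum (G : NFunction) (α T : ℝ) (hα : α ∈ Ioo (0 : ℝ) 1)
    (u v : caputoOrliczSubmodule G α T hα) :
    dist (show SeminormedOf (caputoSumSeminorm G α T hα) from u)
      (show SeminormedOf (caputoSumSeminorm G α T hα) from v) =
      luxNorm G (lam T) (u - v : ℝ → ℝ) +
        luxNorm G (lam T) (caputoDeriv α T u - caputoDeriv α T v) := by
  rw [← luxNorm_congr G (caputoDeriv_sub hα.2 u.2 v.2)]
  exact dist_eq_norm _ _

/-- Functions and derivatives converge separately in `L^G`, hence in `L¹`, where the Caputo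
derivative is closed once the limit is redefined at `0`. This changes the limit only on a null set.
-/
theorem completeSpace_caputoSum (G : NFunction) (α T : ℝ) (hα : α ∈ Ioo (0 : ℝ) 1)
    (hT : 0 < T) : CompleteSpace (SeminormedOf (caputoSumSeminorm G α T hα)) := by
  refine Metric.complete_of_cauchySeq_tendsto fun s hs => ?_
  let v : ℕ → caputoOrliczSubmodule G α T hα := s
  have hd : ∀ m n, dist (s m) (s n) = luxNorm G (lam T) (v m - v n : ℝ → ℝ) +
      luxNorm G (lam T) (caputoDeriv α T (v m) - caputoDeriv α T (v n)) := fun m n =>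
    dist_caputoSum G α T hα (v m) (v n)
  have hs' := Metric.cauchySeq_iff.1 hs
  have hv : ∀ n, MemCaputoOrlicz G α T (v n) := fun n => (v n).2
  obtain ⟨f, hf, hvf⟩ := exists_luxNorm_limit G (lam T) (fun n => v n) (fun n => (hv n).1)
    fun ε hε => by
      obtain ⟨N, hN⟩ := hs' ε hε
      refine ⟨N, fun m hm n hn => lt_of_le_of_lt ?_ (hN m hm n hn)⟩
      rw [hd]
      exact le_add_of_nonneg_right (luxNorm_nonneg _ _ _)
  obtain ⟨z, hz, hvz⟩ := exists_luxNorm_limit G (lam T) (fun n => caputoDeriv α T (v n))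
    (fun n => (hv n).2.2) fun ε hε => by
      obtain ⟨N, hN⟩ := hs' ε hε
      refine ⟨N, fun m hm n hn => lt_of_le_of_lt ?_ (hN m hm n hn)⟩
      rw [hd]
      exact le_add_of_nonneg_left (luxNorm_nonneg _ _ _)
  obtain ⟨c, hc⟩ := exists_hasCaputoDeriv_update hα.2 hT (fun n => (hv n).1.integrable)
    (fun n => (hv n).2.2.integrable) hf.integrable hz.integrable
    (fun n => caputoDeriv_spec (hv n).2.1)
    (tendsto_integral_abs_of_luxNorm (fun n => (hv n).1) hf hvf)
    (tendsto_integral_abs_of_luxNorm (fun n => (hv n).2.2) hz hvz)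
  set g := Function.update f 0 c
  have hgf : f =ᵐ[lam T] g := by
    filter_upwards [ae_restrict_of_ae (Measure.ae_ne volume (0 : ℝ))] with x hx
    exact (Function.update_of_ne hx _ _).symm
  have hgz : z =ᵐ[lam T] caputoDeriv α T g :=
    HasWeakDerivOn.unique hc (caputoDeriv_spec ⟨_, hc⟩)
  have hg : MemCaputoOrlicz G α T g := ⟨hf.congr hgf, ⟨_, hc⟩, hz.congr hgz⟩
  refine ⟨(⟨g, hg⟩ : caputoOrliczSubmodule G α T hα), Metric.tendsto_atTop.2 fun ε hε => ?_⟩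
  obtain ⟨N₁, h₁⟩ := hvf (ε / 3) (by positivity)
  obtain ⟨N₂, h₂⟩ := hvz (ε / 3) (by positivity)
  refine ⟨max N₁ N₂, fun n hn => ?_⟩
  refine (dist_caputoSum G α T hα (v n) ⟨g, hg⟩).trans_lt ?_
  rw [← luxNorm_congr G ((EventuallyEq.refl _ (v n : ℝ → ℝ)).sub hgf),
    ← luxNorm_congr G ((EventuallyEq.refl _ (caputoDeriv α T (v n))).sub hgz)]
  linarith [h₁ n (le_of_max_le_left hn), h₂ n (le_of_max_le_right hn)]

/-- The map to `L^G × L^G` given by a function and its derivative is bi-Lipschitz onto its image for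
the maximum distance. Second countability, unlike bare separability, pulls back along any inducing
map. -/
theorem separableSpace_caputoSum {G : NFunction} (hΔ : G.DeltaTwo) (α T : ℝ)
    (hα : α ∈ Ioo (0 : ℝ) 1) :
    TopologicalSpace.SeparableSpace (SeminormedOf (caputoSumSeminorm G α T hα)) := by
  have := separableSpace_orlicz hΔ (lam T)
  have := UniformSpace.secondCountable_of_separable (SeminormedOf (luxSeminorm G (lam T)))
  let Φ : SeminormedOf (caputoSumSeminorm G α T hα) →
      SeminormedOf (luxSeminorm G (lam T)) × SeminormedOf (luxSeminorm G (lam T)) := fun s =>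
    let v : caputoOrliczSubmodule G α T hα := s
    ((⟨v, v.2.1⟩ : orliczSubmodule G (lam T)),
      (⟨caputoDeriv α T v, v.2.2.2⟩ : orliczSubmodule G (lam T)))
  have hdist : ∀ (a b : orliczSubmodule G (lam T)),
      dist (show SeminormedOf (luxSeminorm G (lam T)) from a)
      (show SeminormedOf (luxSeminorm G (lam T)) from b) = luxNorm G (lam T) (a - b : ℝ → ℝ) :=
    fun a b => (dist_eq_norm _ _).trans (luxSeminorm_apply G (lam T) (a - b))
  have hΦ : ∀ s t, dist (Φ s).1 (Φ t).1 + dist (Φ s).2 (Φ t).2 = dist s t := fun s t => by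
    refine Eq.trans ?_ (dist_caputoSum G α T hα s t).symm
    exact congrArg₂ (· + ·) (hdist _ _) (hdist _ _)
  have h1 : LipschitzWith 1 Φ := LipschitzWith.mk_one fun s t => by
    rw [Prod.dist_eq]
    have := hΦ s t
    exact max_le (by linarith [dist_nonneg (x := (Φ s).2) (y := (Φ t).2)])
      (by linarith [dist_nonneg (x := (Φ s).1) (y := (Φ t).1)])
  have h2 : AntilipschitzWith 2 Φ := AntilipschitzWith.of_le_mul_dist fun s t => by
    rw [Prod.dist_eq, ← hΦ s t, NNReal.coe_ofNat, two_mul]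
    exact add_le_add (le_max_left _ _) (le_max_right _ _)
  have := (h2.isUniformInducing h1.uniformContinuous).isInducing.secondCountableTopology
  infer_instance

/-! ### Doubling and Clarkson inequalities for the modular of `𝒪^{α,G}` -/

lemma caputoModular_two_smul_le (G : NFunction) {k : ℝ} (hk : 0 < k)
    (hΔ : ∀ s : ℝ, 0 ≤ s → G (2 * s) ≤ k * G s) {α T : ℝ} (hα : α ∈ Ioo (0 : ℝ) 1) {v : ℝ → ℝ}
    (hv : MemCaputoOrlicz G α T v) :
    caputoModular G α T ((2 : ℝ) • v) ≤ ENNReal.ofReal k * caputoModular G α T v := by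
  rw [caputoModular_eq G α T ((caputoOrliczSubmodule G α T hα).smul_mem 2 hv),
    caputoModular_eq G α T hv, orliczModular_congr G (caputoDeriv_smul hα.2 hv 2), mul_add]
  exact add_le_add (orliczModular_two_smul_le G hk hΔ _ _) (orliczModular_two_smul_le G hk hΔ _ _)

lemma caputoModular_clarkson (G : NFunction)
    (hG : ConvexOn ℝ (Ici 0) (fun s : ℝ => G (√s))) {α T : ℝ} (hα : α ∈ Ioo (0 : ℝ) 1)
    {u v : ℝ → ℝ} (hu : MemCaputoOrlicz G α T u) (hv : MemCaputoOrlicz G α T v) :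
    caputoModular G α T ((1 / 2 : ℝ) • (u + v)) + caputoModular G α T ((1 / 2 : ℝ) • (u - v)) ≤
      ENNReal.ofReal (1 / 2) * (caputoModular G α T u + caputoModular G α T v) := by
  set O := caputoOrliczSubmodule G α T hα
  have ea : (1 / 2 : ℝ) • (u + v) = (1 / 2 : ℝ) • u + (1 / 2 : ℝ) • v := smul_add _ _ _
  have es : (1 / 2 : ℝ) • (u - v) = (1 / 2 : ℝ) • u + (-(1 / 2) : ℝ) • v := by
    rw [smul_sub, neg_smul, sub_eq_add_neg]
  have da : caputoDeriv α T ((1 / 2 : ℝ) • (u + v)) =ᵐ[lam T]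
      (1 / 2 : ℝ) • (caputoDeriv α T u + caputoDeriv α T v) := by
    rw [ea, smul_add]
    exact caputoDeriv_linear hα.2 hu hv _ _
  have ds : caputoDeriv α T ((1 / 2 : ℝ) • (u - v)) =ᵐ[lam T]
      (1 / 2 : ℝ) • (caputoDeriv α T u - caputoDeriv α T v) := by
    rw [es, smul_sub, sub_eq_add_neg, ← neg_smul]
    exact caputoDeriv_linear hα.2 hu hv _ _
  rw [caputoModular_eq G α T (O.smul_mem (1 / 2) (O.add_mem hu hv)),
    caputoModular_eq G α T (O.smul_mem (1 / 2) (O.sub_mem hu hv)),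
    caputoModular_eq G α T hu, caputoModular_eq G α T hv, orliczModular_congr G da,
    orliczModular_congr G ds, add_add_add_comm,
    add_add_add_comm (orliczModular G (lam T) u), mul_add]
  exact add_le_add (orliczModular_clarkson G hG hu.1.1 hv.1.1)
    (orliczModular_clarkson G hG hu.2.2.1 hv.2.2.1)

theorem uniformConvexSpace_caputoLux {G : NFunction} (hΔ : G.DeltaTwo)
    (hG : ConvexOn ℝ (Ici 0) (fun s : ℝ => G (√s))) (α T : ℝ) (hα : α ∈ Ioo (0 : ℝ) 1) :
    UniformConvexSpace (SeminormedOf (caputoLuxSeminorm G α T hα)) := by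
  obtain ⟨k, hk, hΔ⟩ := hΔ
  exact uniformConvexSpace_modularSeminorm
    (ρ := fun v : caputoOrliczSubmodule G α T hα => caputoModular G α T v) hk
    (fun v => caputoModular_two_smul_le G hk hΔ hα v.2)
    (fun u v => caputoModular_clarkson G hG hα u.2 v.2)

/-! ### Comparison of the norms -/

lemma caputoModular_smul {G : NFunction} {α T : ℝ} (hα : α ∈ Ioo (0 : ℝ) 1) {v : ℝ → ℝ}
    (hv : MemCaputoOrlicz G α T v) (c : ℝ) :
    caputoModular G α T (c • v) =
      orliczModular G (lam T) (c • v) + orliczModular G (lam T) (c • caputoDeriv α T v) := by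
  rw [caputoModular_eq G α T ((caputoOrliczSubmodule G α T hα).smul_mem c hv),
    orliczModular_congr G (caputoDeriv_smul hα.2 hv c)]

/-- `(a + b)⁻¹ • v` is a convex combination of `a⁻¹ • v` and `0`. Used for a function and, with `a`
and `b` exchanged, for its derivative, the two bounds add up to one. -/
lemma orliczModular_inv_add_smul_le {G : NFunction} {μ : Measure ℝ} {v : ℝ → ℝ}
    (hv : AEMeasurable v μ) {a b : ℝ} (ha : 0 < a) (hb : 0 < b)
    (h : orliczModular G μ (a⁻¹ • v) ≤ 1) :
    orliczModular G μ ((a + b)⁻¹ • v) ≤ ENNReal.ofReal (a / (a + b)) := by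
  have hab : 0 < a + b := add_pos ha hb
  have := orliczModular_convex G (hv.const_smul a⁻¹) (v := 0) (a := a / (a + b))
    (b := b / (a + b)) (by positivity) (by positivity) (by field_simp)
  rw [smul_zero, add_zero, orliczModular_zero, mul_zero, add_zero, smul_smul] at this
  have e : a / (a + b) * a⁻¹ = (a + b)⁻¹ := by field_simp
  rw [e] at this
  exact this.trans (mul_le_of_le_one_right' h)

theorem caputoLuxNorm_le_caputoSumNorm {G : NFunction} {α T : ℝ} (hα : α ∈ Ioo (0 : ℝ) 1)
    {v : ℝ → ℝ} (hv : MemCaputoOrlicz G α T v) :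
    caputoLuxNorm G α T v ≤ caputoSumNorm G α T v := by
  refine le_of_forall_pos_le_add fun ε hε => ?_
  -- The slack makes both scales positive and strictly larger than the norms, so the modulars there
  -- are at most one.
  set a := luxNorm G (lam T) v + ε / 2
  set b := luxNorm G (lam T) (caputoDeriv α T v) + ε / 2
  have ha : 0 < a := add_pos_of_nonneg_of_pos (luxNorm_nonneg _ _ _) (half_pos hε)
  have hb : 0 < b := add_pos_of_nonneg_of_pos (luxNorm_nonneg _ _ _) (half_pos hε)
  have e : caputoSumNorm G α T v + ε = a + b := by simp only [caputoSumNorm, a, b]; ring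
  rw [e]
  refine csInf_le ⟨0, fun _ h => h.1.le⟩ ⟨add_pos ha hb, ?_⟩
  rw [caputoModular_smul hα hv]
  have h1 := orliczModular_inv_add_smul_le hv.1.1 ha hb
    (orliczModular_le_one_of_luxNorm_lt hv.1 (lt_add_of_pos_right _ (half_pos hε)))
  have h2 := orliczModular_inv_add_smul_le hv.2.2.1 hb ha
    (orliczModular_le_one_of_luxNorm_lt hv.2.2 (lt_add_of_pos_right _ (half_pos hε)))
  rw [add_comm b a] at h2
  refine (add_le_add h1 h2).trans (le_of_eq ?_)
  rw [← ENNReal.ofReal_add (by positivity) (by positivity), ← add_div,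
    div_self (add_pos ha hb).ne', ENNReal.ofReal_one]

theorem caputoSumNorm_le_two_mul_caputoLuxNorm {G : NFunction} {α T : ℝ}
    (hα : α ∈ Ioo (0 : ℝ) 1) {v : ℝ → ℝ} (hv : MemCaputoOrlicz G α T v) :
    caputoSumNorm G α T v ≤ 2 * caputoLuxNorm G α T v := by
  have key : ∀ ε : ℝ, 0 < ε →
      luxNorm G (lam T) v ≤ caputoLuxNorm G α T v + ε ∧
      luxNorm G (lam T) (caputoDeriv α T v) ≤ caputoLuxNorm G α T v + ε := by
    intro ε hε
    have h0 : 0 ≤ caputoLuxNorm G α T v := Real.sInf_nonneg fun _ h => h.1.le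
    have h : caputoModular G α T ((caputoLuxNorm G α T v + ε)⁻¹ • v) ≤ 1 :=
      modular_le_one_of_lt (ρ := fun v : caputoOrliczSubmodule G α T hα => caputoModular G α T v)
        (v := ⟨v, hv⟩)
        (lt_add_of_pos_right (caputoLuxSeminorm G α T hα ⟨v, hv⟩) hε)
    rw [caputoModular_smul hα hv] at h
    -- Each summand of the modular is at most the sum, so each Luxemburg norm is at most the joint
    -- one; adding the two produces the factor 2.
    exact ⟨luxNorm_le_of_orliczModular_le_one (by positivity) (le_self_add.trans h),
      luxNorm_le_of_orliczModular_le_one (by positivity) (le_add_self.trans h)⟩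
  have h1 := le_of_forall_pos_le_add fun ε hε => (key ε hε).1
  have h2 := le_of_forall_pos_le_add fun ε hε => (key ε hε).2
  rw [caputoSumNorm]
  linarith

theorem mainTheorem3 (G : NFunction) (α T : ℝ) (hα : α ∈ Ioo (0 : ℝ) 1) (hT : 0 < T)
    (hΔ : G.DeltaTwo) (hG : ConvexOn ℝ (Ici 0) (fun s : ℝ => G (√s))) :
    (TopologicalSpace.SeparableSpace (CaputoOrlicz G α T hα) ∧
      UniformConvexSpace (CaputoOrlicz G α T hα) ∧
      IsReflexiveSpace (CaputoOrlicz G α T hα)) ∧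
    (∀ v : ℝ → ℝ, MemCaputoOrlicz G α T v →
      caputoLuxNorm G α T v ≤ caputoSumNorm G α T v ∧
      caputoSumNorm G α T v ≤ 2 * caputoLuxNorm G α T v) ∧
    (TopologicalSpace.SeparableSpace (CaputoOrliczSum G α T hα) ∧
      IsReflexiveSpace (CaputoOrliczSum G α T hα)) := by
  obtain ⟨e⟩ := exists_normedOf_equiv (caputoLuxSeminorm G α T hα) (caputoSumSeminorm G α T hα)
    1 2 (fun v => by
      rw [one_mul]
      exact caputoLuxNorm_le_caputoSumNorm hα v.2)
    (fun v => caputoSumNorm_le_two_mul_caputoLuxNorm hα v.2)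
  have hsepS : TopologicalSpace.SeparableSpace (CaputoOrliczSum G α T hα) := by
    have := separableSpace_caputoSum hΔ α T hα
    exact separableSpace_separationQuotient _
  have hcomplS : CompleteSpace (CaputoOrliczSum G α T hα) :=
    SeparationQuotient.completeSpace_iff.2 (completeSpace_caputoSum G α T hα hT)
  -- Milman–Pettis needs completeness in the uniformly convex norm, so completeness is carried over
  -- from the sum norm; reflexivity travels back along the same `e`.
  have hcompl : CompleteSpace (CaputoOrlicz G α T hα) :=
    (completeSpace_congr (e := e.toEquiv) e.isUniformEmbedding).2 hcomplS
  have huc : UniformConvexSpace (CaputoOrlicz G α T hα) := by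
    have := uniformConvexSpace_caputoLux hΔ hG α T hα
    exact uniformConvexSpace_separationQuotient _
  have hrefl : IsReflexiveSpace (CaputoOrlicz G α T hα) :=
    isReflexiveSpace_of_uniformConvexSpace _
  refine ⟨⟨?_, huc, hrefl⟩, fun v hv => ⟨caputoLuxNorm_le_caputoSumNorm hα hv,
    caputoSumNorm_le_two_mul_caputoLuxNorm hα hv⟩, hsepS, hrefl.of_equiv e⟩
  exact e.symm.surjective.denseRange.separableSpace e.symm.continuous
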